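/- **Theorem (characteristic connections of canonical almost 3-contact metric manifolds).** *Definitions.* Let $(M,g)$ be a smooth Riemannian manifold. An almost contact metric structure on it is a triple $(\varphi,\xi,\eta)$ of a smooth $(1,1)$-tensor field, a smooth vector field and a smooth $1$-form with $\varphi^2=-I+\eta\otimes\xi$, $\eta(\xi)=1$ and $g(\varphi X,\varphi Y)=g(X,Y)-\eta(X)\eta(Y)$. Put $\Phi(X,Y)=g(X,\varphi Y)$ and $$N_\varphi(X,Y)=[\varphi X,\varphi Y]+\varphi^2[X,Y]-\varphi[\varphi X,Y]-\varphi[X,\varphi Y]+d\eta(X,Y)\,\xi,$$ $$N_\varphi(X,Y,Z)=g(N_\varphi(X,Y),Z),$$ where $d\eta(X,Y)=X\eta(Y)-Y\eta(X)-\eta([X,Y])$, and $d\Phi$ is likewise normalized without numerical factor. A *characteristic connection* of $(\varphi,\xi,\eta,g)$ is a smooth linear connection $\nabla$ on $TM$ with $\nabla g=0$, $\nabla\varphi=0$, $\nabla\xi=0$, $\nabla\eta=0$ whose torsion $T$ is totally skew-symmetric, i.e. $g(T(X,Y),Z)$ is a $3$-form. An almost 3-contact metric manifold $(M,\varphi_i,\xi_i,\eta_i,g)$,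 $i=1,2,3$, is a smooth Riemannian manifold $(M,g)$ of dimension $4n+3$ with three almost contact metric structures $(\varphi_i,\xi_i,\eta_i,g)$ such that for every even permutation $(i,j,k)$ of $(1,2,3)$ $$\varphi_k=\varphi_i\varphi_j-\eta_j\otimes\xi_i=-\varphi_j\varphi_i+\eta_i\otimes\xi_j,\quad \xi_k=\varphi_i\xi_j=-\varphi_j\xi_i,\quad \eta_k=\eta_i\circ\varphi_j=-\eta_j\circ\varphi_i .$$ Let $\mathcal H=\bigcap_{i=1}^3\ker\eta_i$ and, for $X,Y\in\Gamma(\mathcal H)$, $$A_{ij}(X,Y)=g((\mathcal L_{\xi_j}\varphi_i)X,Y)+d\eta_j(X,\varphi_iY)+d\eta_j(\varphi_iX,Y).$$ The manifold is called *canonical* if 1. each $N_{\varphi_i}$ is totally skew-symmetric on $\mathcal H$; 2. each $\xi_i$ is a Killing vector field; 3. $N_{\varphi_i}(X,Y,Z)-d\Phi_i(\varphi_iX,\varphi_iY,\varphi_iZ)=N_{\varphi_j}(X,Y,Z)-d\Phi_j(\varphi_jX,\varphi_jY,\varphi_jZ)$ for all $X,Y,Z\in\Gamma(\mathcal H)$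 and all $i,j$; 4. there is a smooth function $\beta$ on $M$ (a Reeb Killing function) such that $A_{ii}(X,Y)=0$ and $A_{ij}(X,Y)=-A_{ji}(X,Y)=\beta\,\Phi_k(X,Y)$ for all $X,Y\in\Gamma(\mathcal H)$ and every even permutation $(i,j,k)$ of $(1,2,3)$. The associated sphere $\Sigma_M$ consists of the almost contact metric structures $(\varphi_a,\xi_a,\eta_a,g)$, $a=(a_1,a_2,a_3)\in S^2\subset\mathbb R^3$, with $\varphi_a=\sum_i a_i\varphi_i$, $\xi_a=\sum_i a_i\xi_i$, $\eta_a=\sum_i a_i\eta_i$. *Statement.* Let $(M,\varphi_i,\xi_i,\eta_i,g)$ be a canonical almost 3-contact metric manifold. Then: 1. for each $i=1,2,3$ the tensor $N_{\varphi_i}$ is totally skew-symmetric on all of $TM$, and the almost contact metric structure $(\varphi_i,\xi_i,\eta_i,g)$ admits a characteristic connection; 2. every almost contact metric structure in the associated sphere $\Sigma_M$ admits a characteristic connection. -/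

import Mathlib

open Bundle VectorField
open scoped Manifold ContDiff

noncomputable section

namespace ContactGeometry

variable {E : Type*} [NormedAddCommGroup E] [NormedSpace ℝ E]
  {H : Type*} [TopologicalSpace H] {I : ModelWithCorners ℝ E H}
  {M : Type*} [TopologicalSpace M] [ChartedSpace H M]

/-! ### Vector fields, forms and endomorphism fields -/

/-- The vector field `X` is smooth. -/
def IsSmoothVF [IsManifold I ∞ M] (X : Π x : M, TangentSpace I x) : Prop :=
  ContMDiff I I.tangent ∞ (fun x => (⟨x, X x⟩ : TangentBundle I M))

/-- The field of endomorphisms `φ` (a `(1,1)`-tensor field) is a smooth section of `End TM`. -/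
def IsSmoothEnd [IsManifold I ∞ M]
    (φ : Π x : M, TangentSpace I x →L[ℝ] TangentSpace I x) : Prop :=
  ContMDiff I (I.prod 𝓘(ℝ, E →L[ℝ] E)) ∞
    (fun x => TotalSpace.mk' (E →L[ℝ] E)
      (E := fun x : M => TangentSpace I x →L[ℝ] TangentSpace I x) x (φ x))

/-- The `1`-form `η` is a smooth section of `T*M`. -/
def IsSmoothOneForm [IsManifold I ∞ M] (η : Π x : M, TangentSpace I x →L[ℝ] ℝ) : Prop :=
  ContMDiff I (I.prod 𝓘(ℝ, E →L[ℝ] ℝ)) ∞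
    (fun x => TotalSpace.mk' (E →L[ℝ] ℝ)
      (E := fun x : M => TangentSpace I x →L[ℝ] Bundle.Trivial M ℝ x) x (η x))

/-- `dη(X,Y) = X(η(Y)) - Y(η(X)) - η([X,Y])`. -/
def dOneForm (η : Π x : M, TangentSpace I x →L[ℝ] ℝ) (X Y : Π x : M, TangentSpace I x)
    (x : M) : ℝ :=
  mvfderiv I (fun y => η y (Y y)) x (X x) - mvfderiv I (fun y => η y (X y)) x (Y x)
    - η x (mlieBracket I X Y x)

/-- The exterior derivative of a `2`-form `Ω`, evaluated on vector fields:
`dΩ(X,Y,Z) = X(Ω(Y,Z)) + Y(Ω(Z,X)) + Z(Ω(X,Y)) - Ω([X,Y],Z) - Ω([Y,Z],X) - Ω([Z,X],Y)`. -/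
def dTwoForm (Ω : Π x : M, TangentSpace I x → TangentSpace I x → ℝ)
    (X Y Z : Π x : M, TangentSpace I x) (x : M) : ℝ :=
  mvfderiv I (fun y => Ω y (Y y) (Z y)) x (X x)
    + mvfderiv I (fun y => Ω y (Z y) (X y)) x (Y x)
    + mvfderiv I (fun y => Ω y (X y) (Y y)) x (Z x)
    - Ω x (mlieBracket I X Y x) (Z x)
    - Ω x (mlieBracket I Y Z x) (X x)
    - Ω x (mlieBracket I Z X x) (Y x)

/-- The Lie derivative of an endomorphism field, `(L_ξ φ) X = [ξ, φ X] - φ [ξ, X]`. -/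
def lieDerivEnd (ξ : Π x : M, TangentSpace I x)
    (φ : Π x : M, TangentSpace I x →L[ℝ] TangentSpace I x) (X : Π x : M, TangentSpace I x)
    (x : M) : TangentSpace I x :=
  mlieBracket I ξ (fun y => φ y (X y)) x - φ x (mlieBracket I ξ X x)

/-- `N_φ(X,Y) = [φX,φY] + φ²[X,Y] - φ[φX,Y] - φ[X,φY] + dη(X,Y) ξ`. -/
def nijenhuis (φ : Π x : M, TangentSpace I x →L[ℝ] TangentSpace I x)
    (ξ : Π x : M, TangentSpace I x) (η : Π x : M, TangentSpace I x →L[ℝ] ℝ)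
    (X Y : Π x : M, TangentSpace I x) (x : M) : TangentSpace I x :=
  mlieBracket I (fun y => φ y (X y)) (fun y => φ y (Y y)) x
    + φ x (φ x (mlieBracket I X Y x))
    - φ x (mlieBracket I (fun y => φ y (X y)) Y x)
    - φ x (mlieBracket I X (fun y => φ y (Y y)) x)
    + dOneForm η X Y x • ξ x

section Metric

variable [IsManifold I ∞ M] [RiemannianBundle (fun x : M => TangentSpace I x)]

/-- The vector field `ξ` is Killing: `(L_ξ g)(X,Y) = ξ(g(X,Y)) - g([ξ,X],Y) - g(X,[ξ,Y])`
vanishes. -/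
def IsKilling (ξ : Π x : M, TangentSpace I x) : Prop :=
  IsSmoothVF ξ ∧ ∀ X Y : Π x : M, TangentSpace I x, IsSmoothVF X → IsSmoothVF Y → ∀ x : M,
    mvfderiv I (fun y => inner ℝ (X y) (Y y)) x (ξ x)
      - inner ℝ (mlieBracket I ξ X x) (Y x) - inner ℝ (X x) (mlieBracket I ξ Y x) = 0

/-- For a vector-valued operation `N` on pairs of vector fields and a distribution `D`:
`(X,Y,Z) ↦ g(N(X,Y),Z)` is totally skew-symmetric on smooth sections of `D`. -/
def IsSkewOn (D : Π x : M, Submodule ℝ (TangentSpace I x))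
    (N : (Π x : M, TangentSpace I x) → (Π x : M, TangentSpace I x) →
      (Π x : M, TangentSpace I x)) : Prop :=
  ∀ X Y Z : Π x : M, TangentSpace I x, IsSmoothVF X → IsSmoothVF Y → IsSmoothVF Z →
    (∀ x, X x ∈ D x) → (∀ x, Y x ∈ D x) → (∀ x, Z x ∈ D x) → ∀ x : M,
      inner ℝ (N Y X x) (Z x) = - inner ℝ (N X Y x) (Z x) ∧
      inner ℝ (N X Z x) (Y x) = - inner ℝ (N X Y x) (Z x)

end Metric

/-! ### Almost contact metric structures -/

variable (I M) in
/-- An almost contact metric structure `(φ, ξ, η, g)`; the Riemannian metric `g` is the ambient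
one. -/
structure AlmostContactMetricStructure [IsManifold I ∞ M]
    [RiemannianBundle (fun x : M => TangentSpace I x)] where
  φ : Π x : M, TangentSpace I x →L[ℝ] TangentSpace I x
  ξ : Π x : M, TangentSpace I x
  η : Π x : M, TangentSpace I x →L[ℝ] ℝ
  smooth_φ : IsSmoothEnd φ
  smooth_ξ : IsSmoothVF ξ
  smooth_η : IsSmoothOneForm η
  φ_sq : ∀ (x : M) (v : TangentSpace I x), φ x (φ x v) = - v + η x v • ξ x
  η_ξ : ∀ x : M, η x (ξ x) = 1
  compatible : ∀ (x : M) (v w : TangentSpace I x),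
    inner ℝ (φ x v) (φ x w) = inner ℝ v w - η x v * η x w

namespace AlmostContactMetricStructure

variable [IsManifold I ∞ M] [RiemannianBundle (fun x : M => TangentSpace I x)]
  (S : AlmostContactMetricStructure I M)

/-- The fundamental `2`-form `Φ(X,Y) = g(X, φY)`. -/
def Φ (x : M) (v w : TangentSpace I x) : ℝ := inner ℝ v (S.φ x w)

/-- The tensor field `N_φ` of the structure. -/
def N (X Y : Π x : M, TangentSpace I x) (x : M) : TangentSpace I x :=
  nijenhuis S.φ S.ξ S.η X Y x

/-- `∇` is a characteristic connection: a smooth metric connection with totally skew-symmetric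
torsion which parallelizes all structure tensors, `∇φ = 0`, `∇ξ = 0`, `∇η = 0`.
Here `cov Y x (X x)` is `∇_X Y` at `x`. -/
structure IsCharacteristicConnection [FiniteDimensional ℝ E]
    (cov : CovariantDerivative I E (fun x : M => TangentSpace I x)) : Prop where
  smooth : CovariantDerivative.ContMDiffCovariantDerivative cov ∞
  metric : ∀ X Y Z : Π x : M, TangentSpace I x, IsSmoothVF X → IsSmoothVF Y → IsSmoothVF Z →
    ∀ x : M, mvfderiv I (fun y => inner ℝ (Y y) (Z y)) x (X x)
      = inner ℝ (cov Y x (X x)) (Z x) + inner ℝ (Y x) (cov Z x (X x))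
  skew_torsion : ∀ (x : M) (u v w : TangentSpace I x),
    inner ℝ (cov.torsion x v u) w = - inner ℝ (cov.torsion x u v) w ∧
    inner ℝ (cov.torsion x u w) v = - inner ℝ (cov.torsion x u v) w
  parallel_φ : ∀ X Y : Π x : M, TangentSpace I x, IsSmoothVF X → IsSmoothVF Y → ∀ x : M,
    cov (fun y => S.φ y (Y y)) x (X x) - S.φ x (cov Y x (X x)) = 0
  parallel_ξ : ∀ X : Π x : M, TangentSpace I x, IsSmoothVF X → ∀ x : M,
    cov S.ξ x (X x) = 0
  parallel_η : ∀ X Y : Π x : M, TangentSpace I x, IsSmoothVF X → IsSmoothVF Y → ∀ x : M,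
    mvfderiv I (fun y => S.η y (Y y)) x (X x) - S.η x (cov Y x (X x)) = 0

variable {S}

theorem φ_ξ (x : M) : S.φ x (S.ξ x) = 0 := by
  have h1 : S.φ x (S.φ x (S.ξ x)) = 0 := by rw [S.φ_sq, S.η_ξ]; simp
  have h2 := S.φ_sq x (S.φ x (S.ξ x))
  rw [h1, map_zero] at h2
  have h3 : S.φ x (S.ξ x) = S.η x (S.φ x (S.ξ x)) • S.ξ x := by
    linear_combination (norm := module) h2
  have h4 : S.η x (S.φ x (S.ξ x)) * S.η x (S.φ x (S.ξ x)) = 0 := by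
    have h5 := congrArg (fun v => S.η x (S.φ x v)) h3
    simp only [h1, map_zero, map_smul, smul_eq_mul] at h5
    exact h5.symm
  rw [h3, mul_self_eq_zero.mp h4, zero_smul]

theorem η_φ (x : M) (v : TangentSpace I x) : S.η x (S.φ x v) = 0 := by
  have h1 := S.φ_sq x (S.φ x v)
  rw [S.φ_sq x v, map_add, map_neg, map_smul, φ_ξ, smul_zero, add_zero] at h1
  have h2 : S.η x (S.φ x v) • S.ξ x = 0 := by linear_combination (norm := module) -h1
  have h3 := congrArg (S.η x) h2
  simpa [S.η_ξ] using h3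

theorem inner_ξ (x : M) (v : TangentSpace I x) : inner ℝ v (S.ξ x) = S.η x v := by
  have h := S.compatible x v (S.ξ x)
  rw [φ_ξ, inner_zero_right, S.η_ξ] at h
  linarith

theorem inner_φ_left (x : M) (v w : TangentSpace I x) :
    inner ℝ (S.φ x v) w = - inner ℝ v (S.φ x w) := by
  have h := S.compatible x v (S.φ x w)
  rw [S.φ_sq, inner_add_right, inner_neg_right, inner_smul_right, inner_ξ, η_φ, η_φ] at h
  linarith

end AlmostContactMetricStructure

/-! ### Almost 3-contact metric structures -/

/-- `(i,j,k)` is an even (that is, cyclic) permutation of the three indices. -/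
def IsEvenPerm (i j k : Fin 3) : Prop := j = i + 1 ∧ k = i + 2

variable (I M) in
/-- An almost 3-contact metric structure `(φ_i, ξ_i, η_i, g)`, `i = 1,2,3` (indexed here by
`Fin 3`). -/
structure AlmostThreeContactMetricStructure [IsManifold I ∞ M]
    [RiemannianBundle (fun x : M => TangentSpace I x)] where
  str : Fin 3 → AlmostContactMetricStructure I M
  φ_eq : ∀ i j k, IsEvenPerm i j k → ∀ (x : M) (v : TangentSpace I x),
    (str k).φ x v = (str i).φ x ((str j).φ x v) - (str j).η x v • (str i).ξ x
  φ_eq' : ∀ i j k, IsEvenPerm i j k → ∀ (x : M) (v : TangentSpace I x),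
    (str k).φ x v = - (str j).φ x ((str i).φ x v) + (str i).η x v • (str j).ξ x
  ξ_eq : ∀ i j k, IsEvenPerm i j k → ∀ x : M, (str k).ξ x = (str i).φ x ((str j).ξ x)
  ξ_eq' : ∀ i j k, IsEvenPerm i j k → ∀ x : M, (str k).ξ x = - (str j).φ x ((str i).ξ x)
  η_eq : ∀ i j k, IsEvenPerm i j k → ∀ (x : M) (v : TangentSpace I x),
    (str k).η x v = (str i).η x ((str j).φ x v)
  η_eq' : ∀ i j k, IsEvenPerm i j k → ∀ (x : M) (v : TangentSpace I x),
    (str k).η x v = - (str j).η x ((str i).φ x v)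

namespace AlmostThreeContactMetricStructure

variable [IsManifold I ∞ M] [RiemannianBundle (fun x : M => TangentSpace I x)]
  (S : AlmostThreeContactMetricStructure I M)

/-- The horizontal distribution, the intersection of the kernels of `η_1, η_2, η_3`. -/
def horizontal (x : M) : Submodule ℝ (TangentSpace I x) :=
  ⨅ i : Fin 3, LinearMap.ker ((S.str i).η x).toLinearMap

/-- `X` is a smooth section of the horizontal distribution. -/
def IsSmoothHorizontal (X : Π x : M, TangentSpace I x) : Prop :=
  IsSmoothVF X ∧ ∀ x, X x ∈ S.horizontal x

/-- `A_{ij}(X,Y) = g((L_{ξ_j} φ_i) X, Y) + dη_j(X, φ_i Y) + dη_j(φ_i X, Y)`. -/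
def A (i j : Fin 3) (X Y : Π x : M, TangentSpace I x) (x : M) : ℝ :=
  inner ℝ (lieDerivEnd (S.str j).ξ (S.str i).φ X x) (Y x)
    + dOneForm (S.str j).η X (fun y => (S.str i).φ y (Y y)) x
    + dOneForm (S.str j).η (fun y => (S.str i).φ y (X y)) Y x

/-- `β` is a Reeb Killing function: a smooth function such that on horizontal fields `A_{ii} = 0`
and `A_{ij} = -A_{ji} = β Φ_k` for every even permutation `(i,j,k)`. -/
def IsReebKillingFunction (β : M → ℝ) : Prop :=
  ContMDiff I 𝓘(ℝ, ℝ) ∞ β ∧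
  ∀ X Y : Π x : M, TangentSpace I x, S.IsSmoothHorizontal X → S.IsSmoothHorizontal Y →
    ∀ i j k, IsEvenPerm i j k → ∀ x : M,
      S.A i i X Y x = 0 ∧
      S.A i j X Y x = - S.A j i X Y x ∧
      S.A i j X Y x = β x * (S.str k).Φ x (X x) (Y x)

/-- `N_{φ_i}(X,Y,Z) - dΦ_i(φ_i X, φ_i Y, φ_i Z)`. -/
def NMinusdΦ (i : Fin 3) (X Y Z : Π x : M, TangentSpace I x) (x : M) : ℝ :=
  inner ℝ ((S.str i).N X Y x) (Z x)
    - dTwoForm (S.str i).Φ (fun y => (S.str i).φ y (X y)) (fun y => (S.str i).φ y (Y y))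
        (fun y => (S.str i).φ y (Z y)) x

/-- The structure is canonical. -/
structure IsCanonical : Prop where
  skew : ∀ i, IsSkewOn S.horizontal (S.str i).N
  killing : ∀ i, IsKilling (S.str i).ξ
  N_sub_dΦ : ∀ i j, ∀ X Y Z : Π x : M, TangentSpace I x,
    S.IsSmoothHorizontal X → S.IsSmoothHorizontal Y → S.IsSmoothHorizontal Z →
    ∀ x : M, S.NMinusdΦ i X Y Z x = S.NMinusdΦ j X Y Z x
  reebKilling : ∃ β : M → ℝ, S.IsReebKillingFunction β

theorem sum_sq_of_mem_sphere {a : EuclideanSpace ℝ (Fin 3)} (ha : a ∈ Metric.sphere 0 1) :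
    a 0 ^ 2 + a 1 ^ 2 + a 2 ^ 2 = 1 := by
  have h := EuclideanSpace.norm_sq_eq a
  rw [mem_sphere_zero_iff_norm.mp ha, Fin.sum_univ_three] at h
  simpa using h.symm

theorem η_ξ_add (i j k : Fin 3) (h : IsEvenPerm i j k) (x : M) :
    (S.str i).η x ((S.str j).ξ x) + (S.str j).η x ((S.str i).ξ x) = 0 := by
  have h' : IsEvenPerm k i j := by
    obtain ⟨rfl, rfl⟩ := h
    exact ⟨by revert i; decide, by revert i; decide⟩
  have h1 := S.η_eq' k i j h' x ((S.str i).ξ x)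
  rw [← S.ξ_eq k i j h' x] at h1
  linarith

theorem inner_φ_add (i j k : Fin 3) (h : IsEvenPerm i j k) (x : M) (v w : TangentSpace I x) :
    inner ℝ ((S.str i).φ x v) ((S.str j).φ x w) + inner ℝ ((S.str j).φ x v) ((S.str i).φ x w)
      = - ((S.str i).η x v * (S.str j).η x w) - (S.str j).η x v * (S.str i).η x w := by
  have h1 : (S.str i).φ x ((S.str j).φ x w) = (S.str k).φ x w + (S.str j).η x w • (S.str i).ξ x := by
    rw [S.φ_eq i j k h x w, sub_add_cancel]
  have h2 : (S.str j).φ x ((S.str i).φ x w)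
      = - (S.str k).φ x w + (S.str i).η x w • (S.str j).ξ x := by
    rw [S.φ_eq' i j k h x w]
    module
  rw [AlmostContactMetricStructure.inner_φ_left, AlmostContactMetricStructure.inner_φ_left, h1, h2]
  simp only [inner_add_right, inner_neg_right, real_inner_smul_right,
    AlmostContactMetricStructure.inner_ξ]
  ring

/-- The almost contact metric structure `(φ_a, ξ_a, η_a, g)` with `φ_a = ∑ a_i φ_i`,
`ξ_a = ∑ a_i ξ_i`, `η_a = ∑ a_i η_i`, for `a` in the unit sphere of `ℝ³`. -/
def combination (a : EuclideanSpace ℝ (Fin 3)) (ha : a ∈ Metric.sphere 0 1) :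
    AlmostContactMetricStructure I M where
  φ x := ∑ i, a i • (S.str i).φ x
  ξ x := ∑ i, a i • (S.str i).ξ x
  η x := ∑ i, a i • (S.str i).η x
  smooth_φ := ContMDiff.sum_section fun i _ => (S.str i).smooth_φ.const_smul_section
  smooth_ξ := ContMDiff.sum_section fun i _ => (S.str i).smooth_ξ.const_smul_section
  smooth_η := ContMDiff.sum_section
    (V := fun x : M => TangentSpace I x →L[ℝ] Bundle.Trivial M ℝ x)
    fun i _ => (S.str i).smooth_η.const_smul_section
  φ_sq x v := by
    have h := sum_sq_of_mem_sphere ha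
    have e01 := S.φ_eq 0 1 2 ⟨rfl, rfl⟩ x v
    have e10 := S.φ_eq' 0 1 2 ⟨rfl, rfl⟩ x v
    have e12 := S.φ_eq 1 2 0 ⟨rfl, rfl⟩ x v
    have e21 := S.φ_eq' 1 2 0 ⟨rfl, rfl⟩ x v
    have e20 := S.φ_eq 2 0 1 ⟨rfl, rfl⟩ x v
    have e02 := S.φ_eq' 2 0 1 ⟨rfl, rfl⟩ x v
    have s0 := (S.str 0).φ_sq x v
    have s1 := (S.str 1).φ_sq x v
    have s2 := (S.str 2).φ_sq x v
    simp only [Fin.sum_univ_three, add_apply, smul_apply, map_add, map_smul, smul_eq_mul]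
    linear_combination (norm := module) h • (-v) + (a 0 ^ 2) • s0 + (a 1 ^ 2) • s1
      + (a 2 ^ 2) • s2 + (a 0 * a 1) • (e10 - e01) + (a 1 * a 2) • (e21 - e12)
      + (a 2 * a 0) • (e02 - e20)
  η_ξ x := by
    have h := sum_sq_of_mem_sphere ha
    have s0 := (S.str 0).η_ξ x
    have s1 := (S.str 1).η_ξ x
    have s2 := (S.str 2).η_ξ x
    have c01 := S.η_ξ_add 0 1 2 ⟨rfl, rfl⟩ x
    have c12 := S.η_ξ_add 1 2 0 ⟨rfl, rfl⟩ x
    have c20 := S.η_ξ_add 2 0 1 ⟨rfl, rfl⟩ x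
    simp only [Fin.sum_univ_three, add_apply, smul_apply, map_add, map_smul, smul_eq_mul]
    linear_combination h + a 0 ^ 2 * s0 + a 1 ^ 2 * s1 + a 2 ^ 2 * s2 + a 0 * a 1 * c01
      + a 1 * a 2 * c12 + a 2 * a 0 * c20
  compatible x v w := by
    have h := sum_sq_of_mem_sphere ha
    have s0 := (S.str 0).compatible x v w
    have s1 := (S.str 1).compatible x v w
    have s2 := (S.str 2).compatible x v w
    have c01 := S.inner_φ_add 0 1 2 ⟨rfl, rfl⟩ x v w
    have c12 := S.inner_φ_add 1 2 0 ⟨rfl, rfl⟩ x v w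
    have c20 := S.inner_φ_add 2 0 1 ⟨rfl, rfl⟩ x v w
    simp only [Fin.sum_univ_three, add_apply, smul_apply, smul_eq_mul, inner_add_left,
      inner_add_right, real_inner_smul_left, real_inner_smul_right]
    linear_combination h * inner ℝ v w + a 0 ^ 2 * s0 + a 1 ^ 2 * s1 + a 2 ^ 2 * s2
      + a 0 * a 1 * c01 + a 1 * a 2 * c12 + a 2 * a 0 * c20

/-- The associated sphere of almost contact metric structures. -/
def associatedSphere : Set (AlmostContactMetricStructure I M) :=
  {T | ∃ (a : EuclideanSpace ℝ (Fin 3)) (ha : a ∈ Metric.sphere 0 1), T = S.combination a ha}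

end AlmostThreeContactMetricStructure

end ContactGeometry

end

open ContactGeometry

/-! A metric connection with totally skew torsion `T` must be `∇^g + T/2`, with `∇^g` the
Levi-Civita connection. So for each unit vector `a` it suffices to find a smooth 3-form `T_a` whose
connection makes `φ_a` parallel; then `ξ_a` and `η_a` are parallel automatically
(`isCharacteristicConnection_of_parallel_φ`). Skewness of `N_φ` on all of `TM` is a consequence, not
an ingredient: a characteristic connection gives `N(X,Y,Z) = T(X,Y,Z) - T(φX,φY,Z) - T(φX,Y,φZ) -
T(X,φY,φZ)` (`IsCharacteristicConnection.N_eq`, `isSkewOn_N`).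

All the `T_a` come from one 3-form `T`, the torsion of a connection `∇` that rotates the three
structures into each other: `∇_u φ_i = β (η_k(u) φ_j - η_j(u) φ_k)` for even `(i,j,k)`
(`defect_eq_zero`). `T` is assembled by type. Its horizontal part is `N_{φ_i} -
dΦ_i(φ_i·,φ_i·,φ_i·)`, skew by condition 1 and independent of `i` by condition 3. The mixed parts
come from the `dη_l`. The coefficient of the vertical volume form is chosen so that the `ξ_i` rotate
by the same law (`P_add_torsion`). The law for `φ_i` is then checked type by type: on Reeb vectors
it follows from the law for `ξ_i`, along a Reeb direction on horizontal vectors it is condition 4,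
and on horizontal triples it is the skewness of `N`.

Finally `T_a = T + β (∑ η_l ∧ Φ_l - η_a ∧ Φ_a)`: the added form cancels exactly the rotation of
`φ_a` (`sumEtaPhi_sub_etaPhi`, `D_add_charTorsion`). The coordinate vectors give the three given
structures, general `a` the associated sphere.

These verifications are algebra at one point. `LinearCanonical` records the values of `∇^g φ_i` and
`∇^g ξ_i` with the identities they satisfy, and `toLinearCanonical` extracts it from a canonical
structure. The Levi-Civita connection itself is built from the Koszul formula. -/

namespace ContactGeometry

variable {E : Type*} [NormedAddCommGroup E] [NormedSpace ℝ E]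
  {H : Type*} [TopologicalSpace H] {I : ModelWithCorners ℝ E H}
  {M : Type*} [TopologicalSpace M] [ChartedSpace H M] [IsManifold I ∞ M]

/-! ### Calculus of smooth vector fields -/

namespace IsSmoothVF

variable {X Y : Π x : M, TangentSpace I x}

theorem mdifferentiableAt (hX : IsSmoothVF X) (x : M) :
    MDifferentiableAt I I.tangent (fun x => (⟨x, X x⟩ : TangentBundle I M)) x :=
  ContMDiff.mdifferentiable hX (by simp) x

theorem add (hX : IsSmoothVF X) (hY : IsSmoothVF Y) : IsSmoothVF (fun x => X x + Y x) :=
  ContMDiff.add_section hX hY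

theorem sub (hX : IsSmoothVF X) (hY : IsSmoothVF Y) : IsSmoothVF (fun x => X x - Y x) :=
  ContMDiff.sub_section hX hY

theorem smul {f : M → ℝ} (hf : ContMDiff I 𝓘(ℝ, ℝ) ∞ f) (hX : IsSmoothVF X) :
    IsSmoothVF (fun x => f x • X x) :=
  ContMDiff.smul_section hf hX

theorem sum {ι : Type*} {s : Finset ι} {X : ι → Π x : M, TangentSpace I x}
    (hX : ∀ i ∈ s, IsSmoothVF (X i)) : IsSmoothVF (fun x => ∑ i ∈ s, X i x) :=
  ContMDiff.sum_section hX

theorem end_apply {φ : Π x : M, TangentSpace I x →L[ℝ] TangentSpace I x} (hφ : IsSmoothEnd φ)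
    (hX : IsSmoothVF X) : IsSmoothVF (fun x => φ x (X x)) :=
  ContMDiff.clm_bundle_apply (F₁ := E) (F₂ := E) hφ hX

theorem mlieBracket [CompleteSpace E] (hX : IsSmoothVF X) (hY : IsSmoothVF Y) :
    IsSmoothVF (mlieBracket I X Y) :=
  haveI : IsManifold I (minSmoothness ℝ 2) M := by simpa using (inferInstance : IsManifold I 2 M)
  haveI : IsManifold I (((⊤ : ℕ∞) : ℕ∞ω) + 1) M := by simpa using ‹IsManifold I ∞ M›
  ContDiff.mlieBracket_vectorField (m := (⊤ : ℕ∞)) (n := (⊤ : ℕ∞)) hX hY (by simp)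

theorem mvfderiv_apply {f : M → ℝ} (hf : ContMDiff I 𝓘(ℝ, ℝ) ∞ f) (hX : IsSmoothVF X) :
    ContMDiff I 𝓘(ℝ, ℝ) ∞ (fun x => mvfderiv I f x (X x)) := by
  have h1 : ContMDiff I.tangent (𝓘(ℝ, ℝ)).tangent ∞ (tangentMap I 𝓘(ℝ, ℝ) f) :=
    hf.contMDiff_tangentMap (by simp)
  have h2 := h1.comp hX
  intro x
  have h3 := h2 x
  simp only [contMDiffAt_totalSpace] at h3
  have h4 := by simpa [tangentMap, Function.comp_def] using h3.2
  exact h4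

section Metric

variable [RiemannianBundle (fun x : M => TangentSpace I x)]
  [IsContMDiffRiemannianBundle I ∞ E (fun x : M => TangentSpace I x)]

theorem inner (hX : IsSmoothVF X) (hY : IsSmoothVF Y) :
    ContMDiff I 𝓘(ℝ, ℝ) ∞ (fun x => inner ℝ (X x) (Y x)) :=
  ContMDiff.inner_bundle (b := fun x => x) hX hY

end Metric

end IsSmoothVF

/-! ### Global extensions of tangent vectors -/

section Extension

variable [FiniteDimensional ℝ E] [T2Space M]

/-- A bump function supported in the trivialization domain cuts off the local section with constant
coordinates `v`. Agreement on a neighbourhood, rather than only at `x₀`, is what allows coordinate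
expressions to be read off from global fields. -/
theorem exists_isSmoothVF_eventuallyEq (x₀ : M) (v : E) :
    ∃ X : Π x : M, TangentSpace I x, IsSmoothVF X ∧
      ∀ᶠ x in nhds x₀, X x = (trivializationAt E (TangentSpace I) x₀).symm x v := by
  set t := trivializationAt E (TangentSpace I : M → Type _) x₀
  obtain ⟨f, -, hf⟩ := (SmoothBumpFunction.nhds_basis_tsupport (I := I) x₀).mem_iff.1
    (t.open_baseSet.mem_nhds (FiberBundle.mem_baseSet_trivializationAt' x₀))
  refine ⟨fun x => f x • t.symm x v, ?_, ?_⟩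
  · have h : ContMDiffOn I I.tangent ∞
        (fun x => (⟨x, t.symm x v⟩ : TangentBundle I M)) t.baseSet := by
      intro x hx
      rw [t.contMDiffWithinAt_section _ hx]
      refine (contMDiffOn_const (c := v)).congr (fun y hy => ?_) x hx
      simp [t.apply_mk_symm hy]
    have h2 := ContMDiffOn.smul_section_of_tsupport f.contMDiff.contMDiffOn t.open_baseSet hf h
    exact h2
  · filter_upwards [f.eventuallyEq_one] with x hx
    simp [hx]

theorem exists_isSmoothVF_apply_eq (x₀ : M) (v : TangentSpace I x₀) :
    ∃ X : Π x : M, TangentSpace I x, IsSmoothVF X ∧ X x₀ = v := by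
  set t := trivializationAt E (TangentSpace I : M → Type _) x₀
  have hx := FiberBundle.mem_baseSet_trivializationAt' (F := E) (E := (TangentSpace I : M → Type _)) x₀
  obtain ⟨X, hX, h⟩ := exists_isSmoothVF_eventuallyEq (I := I) x₀ (t ⟨x₀, v⟩).2
  refine ⟨X, hX, ?_⟩
  rw [h.self_of_nhds]
  exact t.symm_apply_apply_mk hx v

end Extension

end ContactGeometry

/-! ### Smoothness criteria: testing tensor fields against smooth vector fields -/

namespace ContactGeometry

variable {E : Type*} [NormedAddCommGroup E] [NormedSpace ℝ E]
  {H : Type*} [TopologicalSpace H] {I : ModelWithCorners ℝ E H}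
  {M : Type*} [TopologicalSpace M] [ChartedSpace H M] [IsManifold I ∞ M]

omit [IsManifold I ∞ M] in
theorem contMDiffAt_clm_of_apply [FiniteDimensional ℝ E] {G : M → E →L[ℝ] E} {x₀ : M}
    (h : ∀ v, ContMDiffAt I 𝓘(ℝ, E) ∞ (fun x => G x v) x₀) :
    ContMDiffAt I 𝓘(ℝ, E →L[ℝ] E) ∞ G x₀ := by
  let b := Module.finBasis ℝ E
  let c := fun i => LinearMap.toContinuousLinearMap (b.coord i)
  have hG : G = fun x => ∑ i, (ContinuousLinearMap.smulRightL ℝ E E (c i)) (G x (b i)) := by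
    funext x
    ext v
    have hv := congrArg (G x) (b.sum_repr v)
    rw [map_sum] at hv
    simp only [map_smul] at hv
    simp [c, hv]
  rw [hG]
  exact contMDiffAt_finsetSum fun i _ =>
    (ContinuousLinearMap.contMDiff _).contMDiffAt.comp x₀ (h (b i))

omit [IsManifold I ∞ M] in
theorem contMDiff_det {ι : Type*} [Fintype ι] [DecidableEq ι] {A : M → Matrix ι ι ℝ}
    (h : ∀ i j, ContMDiff I 𝓘(ℝ, ℝ) ∞ (fun x => A x i j)) :
    ContMDiff I 𝓘(ℝ, ℝ) ∞ (fun x => (A x).det) := by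
  simp only [Matrix.det_apply, Units.smul_def, zsmul_eq_mul]
  exact contMDiff_finsetSum fun σ _ => contMDiff_const.mul (contMDiff_finsetProd fun i _ => h _ _)

section

variable [FiniteDimensional ℝ E] [T2Space M]

/-- Near `x₀`, the coordinate matrix of `A` applied to a fixed `v` is the coordinate expression of
`A X`, where `X` is a global field with constant coordinates `v` there. -/
theorem isSmoothEnd_of_apply {A : Π x : M, TangentSpace I x →L[ℝ] TangentSpace I x}
    (h : ∀ X : Π x : M, TangentSpace I x, IsSmoothVF X → IsSmoothVF (fun x => A x (X x))) :
    IsSmoothEnd A := by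
  intro x₀
  rw [contMDiffAt_hom_bundle]
  refine ⟨contMDiffAt_id, contMDiffAt_clm_of_apply fun v => ?_⟩
  obtain ⟨X, hX, hXv⟩ := exists_isSmoothVF_eventuallyEq (I := I) x₀ v
  have h1 := h X hX x₀
  rw [contMDiffAt_section] at h1
  refine h1.congr_of_eventuallyEq ?_
  set t := trivializationAt E (TangentSpace I : M → Type _) x₀
  filter_upwards [hXv, t.open_baseSet.mem_nhds (FiberBundle.mem_baseSet_trivializationAt' x₀)]
    with x hx hxt
  rw [ContinuousLinearMap.inCoordinates_eq hxt hxt, hx]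
  simp [t]

variable [RiemannianBundle (fun x : M => TangentSpace I x)]
  [IsContMDiffRiemannianBundle I ∞ E (fun x : M => TangentSpace I x)]

/-- In a local frame the coefficients of `W` solve a linear system whose matrix is the Gram matrix
of the frame; Cramer's rule writes them as quotients of smooth determinants with nonvanishing
denominator. This makes connections that are defined only through inner products smooth. -/
theorem isSmoothVF_of_inner {W : Π x : M, TangentSpace I x}
    (h : ∀ Z : Π x : M, TangentSpace I x, IsSmoothVF Z →
      ContMDiff I 𝓘(ℝ, ℝ) ∞ (fun x => inner ℝ (Z x) (W x))) :
    IsSmoothVF W := by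
  classical
  intro x₀
  let b := Module.finBasis ℝ E
  choose X hX hXb using fun i => exists_isSmoothVF_eventuallyEq (I := I) x₀ (b i)
  let G := fun x => Matrix.gram ℝ (fun i => X i x)
  let r := fun x i => inner ℝ (X i x) (W x)
  have hG : ∀ i j, ContMDiff I 𝓘(ℝ, ℝ) ∞ (fun x => G x i j) := fun i j => (hX i).inner (hX j)
  have hr : ∀ i, ContMDiff I 𝓘(ℝ, ℝ) ∞ (fun x => r x i) := fun i => h _ (hX i)
  have hc : ∀ i, ContMDiff I 𝓘(ℝ, ℝ) ∞ (fun x => (G x).cramer (r x) i) := by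
    intro i
    simp only [Matrix.cramer_apply]
    refine contMDiff_det fun j k => ?_
    by_cases hk : k = i
    · subst hk; simpa using hr j
    · simpa [Matrix.updateCol_ne hk] using hG j k
  set t := trivializationAt E (TangentSpace I : M → Type _) x₀
  have ht := t.open_baseSet.mem_nhds (FiberBundle.mem_baseSet_trivializationAt' x₀)
  have hbasis : ∀ᶠ x in nhds x₀, ∃ e : Module.Basis _ ℝ (TangentSpace I x), ∀ i, X i x = e i := by
    filter_upwards [Filter.eventually_all.2 hXb, ht] with x hx hxt
    refine ⟨t.basisAt b hxt, fun i => ?_⟩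
    rw [hx]
    simp [Trivialization.basisAt, t]
  have hdet : ∀ᶠ x in nhds x₀, (G x).det ≠ 0 := by
    filter_upwards [hbasis] with x ⟨e, he⟩
    rw [Matrix.det_gram_ne_zero_iff_linearIndependent]
    simpa only [he] using e.linearIndependent
  have hW : ∀ᶠ x in nhds x₀, W x = ∑ i, ((G x).cramer (r x) i / (G x).det) • X i x := by
    filter_upwards [hbasis, hdet] with x ⟨e, he⟩ hd
    refine InnerProductSpace.ext_inner_left_basis e fun i => ?_
    have h1 := congrFun (Matrix.mulVec_cramer (G x) (r x)) i
    simp only [Matrix.mulVec, dotProduct, Pi.smul_apply, smul_eq_mul] at h1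
    rw [← he, inner_sum]
    simp only [real_inner_smul_right]
    change r x i = _
    rw [eq_comm, ← mul_right_inj' hd, ← h1, Finset.mul_sum]
    refine Finset.sum_congr rfl fun j _ => ?_
    have h2 : ∀ a d g : ℝ, d ≠ 0 → d * (a / d * g) = g * a := fun a d g hd => by field_simp
    exact h2 _ _ _ hd
  have hs : ContMDiffAt I I.tangent ∞ (fun x => (⟨x, ∑ i, ((G x).cramer (r x) i / (G x).det) • X i x⟩ :
      TangentBundle I M)) x₀ :=
    ContMDiffAt.sum_section fun i _ => ContMDiffAt.smul_section
      ((hc i x₀).div₀ (contMDiff_det hG x₀) hdet.self_of_nhds) (hX i x₀)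
  exact hs.congr_of_eventuallyEq (hW.mono fun x hx => by simp [hx])

end

end ContactGeometry

namespace ContactGeometry

variable {E : Type*} [NormedAddCommGroup E] [NormedSpace ℝ E]
  {H : Type*} [TopologicalSpace H] {I : ModelWithCorners ℝ E H}
  {M : Type*} [TopologicalSpace M] [ChartedSpace H M] [IsManifold I ∞ M]
  [RiemannianBundle (fun x : M => TangentSpace I x)]

/-! ### The Levi-Civita connection -/

/-- The right-hand side of the Koszul formula for `2 g(∇_X Y, Z)`. -/
noncomputable def koszul (X Y Z : Π x : M, TangentSpace I x) (x : M) : ℝ :=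
  mvfderiv I (fun y => inner ℝ (Y y) (Z y)) x (X x)
    + mvfderiv I (fun y => inner ℝ (Z y) (X y)) x (Y x)
    - mvfderiv I (fun y => inner ℝ (X y) (Y y)) x (Z x)
    + inner ℝ (mlieBracket I X Y x) (Z x)
    - inner ℝ (mlieBracket I Y Z x) (X x)
    + inner ℝ (mlieBracket I Z X x) (Y x)

section Koszul

variable [IsContMDiffRiemannianBundle I ∞ E (fun x : M => TangentSpace I x)] [CompleteSpace E]
  {X X' Y Y' Z Z' : Π x : M, TangentSpace I x} {x : M} {f : M → ℝ}

omit [CompleteSpace E] in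
theorem mdifferentiableAt_inner (hX : MDiffAt (T% X) x) (hY : MDiffAt (T% Y) x) :
    MDifferentiableAt I 𝓘(ℝ, ℝ) (fun y => inner ℝ (X y) (Y y)) x :=
  MDifferentiableAt.inner_bundle (IB := I) (F := E) (E := fun x : M => TangentSpace I x)
    (b := fun y => y) hX hY

theorem koszul_add_left (hX : MDiffAt (T% X) x) (hX' : MDiffAt (T% X') x)
    (hY : MDiffAt (T% Y) x) (hZ : MDiffAt (T% Z) x) :
    koszul (X + X') Y Z x = koszul X Y Z x + koszul X' Y Z x := by
  simp only [koszul, Pi.add_apply, inner_add_left, inner_add_right,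
    mvfderiv_fun_add (mdifferentiableAt_inner hZ hX) (mdifferentiableAt_inner hZ hX'),
    mvfderiv_fun_add (mdifferentiableAt_inner hX hY) (mdifferentiableAt_inner hX' hY),
    mlieBracket_add_left hX hX', mlieBracket_add_right hX hX', map_add, add_apply]
  ring

theorem koszul_smul_left (hf : MDiffAt f x) (hX : MDiffAt (T% X) x)
    (hY : MDiffAt (T% Y) x) (hZ : MDiffAt (T% Z) x) :
    koszul (f • X) Y Z x = f x * koszul X Y Z x := by
  simp only [koszul, Pi.smul_apply', real_inner_smul_left, real_inner_smul_right,
    inner_add_left, neg_smul, inner_neg_left,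
    mvfderiv_fun_mul hf (mdifferentiableAt_inner hX hZ),
    mvfderiv_fun_mul hf (mdifferentiableAt_inner hX hY),
    mlieBracket_smul_left hf hX, mlieBracket_smul_right hf hX, map_smul, add_apply, smul_apply,
    smul_eq_mul, real_inner_comm]
  ring

theorem koszul_add_middle (hX : MDiffAt (T% X) x)
    (hY : MDiffAt (T% Y) x) (hY' : MDiffAt (T% Y') x) (hZ : MDiffAt (T% Z) x) :
    koszul X (Y + Y') Z x = koszul X Y Z x + koszul X Y' Z x := by
  simp only [koszul, Pi.add_apply, inner_add_left, inner_add_right,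
    mvfderiv_fun_add (mdifferentiableAt_inner hY hZ) (mdifferentiableAt_inner hY' hZ),
    mvfderiv_fun_add (mdifferentiableAt_inner hX hY) (mdifferentiableAt_inner hX hY'),
    mlieBracket_add_left hY hY', mlieBracket_add_right hY hY', map_add, add_apply]
  ring

/-- The middle slot is the only one that is not tensorial; the extra term becomes the Leibniz rule
of the connection. -/
theorem koszul_smul_middle (hf : MDiffAt f x) (hX : MDiffAt (T% X) x)
    (hY : MDiffAt (T% Y) x) (hZ : MDiffAt (T% Z) x) :
    koszul X (f • Y) Z x
      = f x * koszul X Y Z x + 2 * mvfderiv I f x (X x) * inner ℝ (Y x) (Z x) := by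
  simp only [koszul, Pi.smul_apply', real_inner_smul_left, real_inner_smul_right,
    inner_add_left, neg_smul, inner_neg_left,
    mvfderiv_fun_mul hf (mdifferentiableAt_inner hY hZ),
    mvfderiv_fun_mul hf (mdifferentiableAt_inner hX hY),
    mlieBracket_smul_left hf hY, mlieBracket_smul_right hf hY, map_smul, add_apply, smul_apply,
    smul_eq_mul, real_inner_comm]
  ring

theorem koszul_add_right (hX : MDiffAt (T% X) x)
    (hY : MDiffAt (T% Y) x) (hZ : MDiffAt (T% Z) x) (hZ' : MDiffAt (T% Z') x) :
    koszul X Y (Z + Z') x = koszul X Y Z x + koszul X Y Z' x := by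
  simp only [koszul, Pi.add_apply, inner_add_left, inner_add_right,
    mvfderiv_fun_add (mdifferentiableAt_inner hY hZ) (mdifferentiableAt_inner hY hZ'),
    mvfderiv_fun_add (mdifferentiableAt_inner hZ hX) (mdifferentiableAt_inner hZ' hX),
    mlieBracket_add_left hZ hZ', mlieBracket_add_right hZ hZ', map_add, add_apply]
  ring

theorem koszul_smul_right (hf : MDiffAt f x) (hX : MDiffAt (T% X) x)
    (hY : MDiffAt (T% Y) x) (hZ : MDiffAt (T% Z) x) :
    koszul X Y (f • Z) x = f x * koszul X Y Z x := by
  simp only [koszul, Pi.smul_apply', real_inner_smul_left, real_inner_smul_right,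
    inner_add_left, neg_smul, inner_neg_left,
    mvfderiv_fun_mul hf (mdifferentiableAt_inner hY hZ),
    mvfderiv_fun_mul hf (mdifferentiableAt_inner hX hZ),
    mlieBracket_smul_left hf hZ, mlieBracket_smul_right hf hZ, map_smul, add_apply, smul_apply,
    smul_eq_mul, real_inner_comm]
  ring

-- The source of metric compatibility.
omit [IsManifold I ∞ M] [IsContMDiffRiemannianBundle I ∞ E fun x : M => TangentSpace I x]
  [CompleteSpace E] in
theorem koszul_add_koszul_swap_right :
    koszul X Y Z x + koszul X Z Y x = 2 * mvfderiv I (fun y => inner ℝ (Y y) (Z y)) x (X x) := by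
  simp only [koszul, mlieBracket_swap_apply (V := X) (W := Y), mlieBracket_swap_apply (V := Z) (W := Y),
    mlieBracket_swap_apply (V := Z) (W := X), inner_neg_left, real_inner_comm]
  ring

-- The source of vanishing torsion.
omit [IsManifold I ∞ M] [IsContMDiffRiemannianBundle I ∞ E fun x : M => TangentSpace I x]
  [CompleteSpace E] in
theorem koszul_sub_koszul_swap_left :
    koszul X Y Z x - koszul Y X Z x = 2 * inner ℝ (mlieBracket I X Y x) (Z x) := by
  simp only [koszul, mlieBracket_swap_apply (V := Y) (W := X), mlieBracket_swap_apply (V := Z) (W := Y),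
    mlieBracket_swap_apply (V := Z) (W := X), inner_neg_left, real_inner_comm]
  ring

end Koszul

section LeviCivita

variable [IsContMDiffRiemannianBundle I ∞ E (fun x : M => TangentSpace I x)]
  [FiniteDimensional ℝ E]
  {X Y Z : Π x : M, TangentSpace I x} {x : M}

omit [IsManifold I ∞ M] [RiemannianBundle fun x : M => TangentSpace I x]
  [IsContMDiffRiemannianBundle I ∞ E fun x : M => TangentSpace I x] in
theorem finiteDimensional_tangentSpace (x : M) : FiniteDimensional ℝ (TangentSpace I x) :=
  inferInstanceAs (FiniteDimensional ℝ E)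

omit [IsManifold I ∞ M] [IsContMDiffRiemannianBundle I ∞ E fun x : M => TangentSpace I x] in
theorem completeSpace_tangentSpace (x : M) : CompleteSpace (TangentSpace I x) :=
  have := finiteDimensional_tangentSpace (I := I) x
  FiniteDimensional.complete ℝ _

/-- The Koszul bilinear form of a vector field differentiable at `x`. -/
noncomputable def koszulHom (Y : Π x : M, TangentSpace I x) (x : M) (hY : MDiffAt (T% Y) x) :
    TangentSpace I x →L[ℝ] TangentSpace I x →L[ℝ] ℝ :=
  TensorialAt.mkHom₂ (I := I) (F := E) (F' := E) (fun X Z => koszul X Y Z x) x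
    (fun _ hZ => ⟨fun hf hX => koszul_smul_left hf hX hY hZ,
      fun hX hX' => koszul_add_left hX hX' hY hZ⟩)
    (fun _ hX => ⟨fun hf hZ => koszul_smul_right hf hX hY hZ,
      fun hZ hZ' => koszul_add_right hX hY hZ hZ'⟩)

open Classical in
/-- The Levi-Civita connection as a bare operation on vector fields. -/
noncomputable def leviCivitaFun (Y : Π x : M, TangentSpace I x) (x : M) :
    TangentSpace I x →L[ℝ] TangentSpace I x :=
  haveI := completeSpace_tangentSpace (I := I) x
  if hY : MDiffAt (T% Y) x then
    (1 / 2 : ℝ) • InnerProductSpace.continuousLinearMapOfBilin (𝕜 := ℝ) (koszulHom Y x hY)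
  -- The value at non-differentiable fields is immaterial: the axioms of a covariant derivative only
  -- concern fields differentiable at the point.
  else 0

theorem inner_leviCivitaFun (hX : MDiffAt (T% X) x) (hY : MDiffAt (T% Y) x)
    (hZ : MDiffAt (T% Z) x) :
    inner ℝ (leviCivitaFun Y x (X x)) (Z x) = 1 / 2 * koszul X Y Z x := by
  have := completeSpace_tangentSpace (I := I) x
  rw [leviCivitaFun, dif_pos hY, smul_apply, real_inner_smul_left,
    InnerProductSpace.continuousLinearMapOfBilin_apply, koszulHom, TensorialAt.mkHom₂_apply _ _ hX hZ]

omit [IsContMDiffRiemannianBundle I ∞ E fun x : M => TangentSpace I x] [FiniteDimensional ℝ E] in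
theorem tangentSpace_ext_inner {v w : TangentSpace I x}
    (h : ∀ Z : Π x : M, TangentSpace I x, MDiffAt (T% Z) x → inner ℝ v (Z x) = inner ℝ w (Z x)) :
    v = w := by
  refine ext_inner_right ℝ fun z => ?_
  simpa using h (FiberBundle.extend E z) (FiberBundle.mdifferentiableAt_extend I E z)

/-- The Levi-Civita connection of a smooth Riemannian manifold. -/
noncomputable def leviCivita : CovariantDerivative I E (fun x : M => TangentSpace I x) where
  toFun := leviCivitaFun
  isCovariantDerivativeOnUniv := by
    constructor
    · intro Y Y' x hY hY' _
      ext u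
      have hu := FiberBundle.mdifferentiableAt_extend I E u
      refine tangentSpace_ext_inner fun Z hZ => ?_
      have h := inner_leviCivitaFun hu (mdifferentiableAt_add_section hY hY') hZ
      have h1 := inner_leviCivitaFun hu hY hZ
      have h2 := inner_leviCivitaFun hu hY' hZ
      rw [koszul_add_middle hu hY hY' hZ] at h
      simp only [FiberBundle.extend_apply_self] at h h1 h2
      rw [add_apply, inner_add_left, h, h1, h2]
      ring
    · intro Y f x hY hf _
      ext u
      have hu := FiberBundle.mdifferentiableAt_extend I E u
      refine tangentSpace_ext_inner fun Z hZ => ?_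
      have h := inner_leviCivitaFun hu (hf.smul_section hY) hZ
      have h1 := inner_leviCivitaFun hu hY hZ
      rw [koszul_smul_middle hf hu hY hZ] at h
      simp only [FiberBundle.extend_apply_self] at h h1
      rw [add_apply, inner_add_left, h, smul_apply, real_inner_smul_left, h1,
        ContinuousLinearMap.smulRight_apply, real_inner_smul_left]
      ring

theorem inner_leviCivita (hX : MDiffAt (T% X) x) (hY : MDiffAt (T% Y) x) (hZ : MDiffAt (T% Z) x) :
    inner ℝ (leviCivita Y x (X x)) (Z x) = 1 / 2 * koszul X Y Z x :=
  inner_leviCivitaFun hX hY hZ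

theorem mvfderiv_inner_leviCivita (hY : MDiffAt (T% Y) x) (hZ : MDiffAt (T% Z) x)
    (u : TangentSpace I x) :
    mvfderiv I (fun y => inner ℝ (Y y) (Z y)) x u
      = inner ℝ (leviCivita Y x u) (Z x) + inner ℝ (Y x) (leviCivita Z x u) := by
  have hu := FiberBundle.mdifferentiableAt_extend I E u
  have h1 := inner_leviCivita hu hY hZ
  have h2 := inner_leviCivita hu hZ hY
  have h3 := koszul_add_koszul_swap_right (X := FiberBundle.extend E u) (Y := Y) (Z := Z) (x := x)
  simp only [FiberBundle.extend_apply_self] at h1 h2 h3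
  rw [real_inner_comm (leviCivita Z x u), h1, h2]
  linarith

theorem leviCivita_sub_swap (hX : MDiffAt (T% X) x) (hY : MDiffAt (T% Y) x) :
    leviCivita Y x (X x) - leviCivita X x (Y x) = mlieBracket I X Y x := by
  refine tangentSpace_ext_inner fun Z hZ => ?_
  rw [inner_sub_left, inner_leviCivita hX hY hZ, inner_leviCivita hY hX hZ]
  linarith [koszul_sub_koszul_swap_left (X := X) (Y := Y) (Z := Z) (x := x)]

theorem contMDiff_koszul (hX : IsSmoothVF X) (hY : IsSmoothVF Y) (hZ : IsSmoothVF Z) :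
    ContMDiff I 𝓘(ℝ, ℝ) ∞ (koszul X Y Z) :=
  (((((hX.mvfderiv_apply (hY.inner hZ)).add (hY.mvfderiv_apply (hZ.inner hX))).sub
    (hZ.mvfderiv_apply (hX.inner hY))).add ((hX.mlieBracket hY).inner hZ)).sub
    ((hY.mlieBracket hZ).inner hX)).add ((hZ.mlieBracket hX).inner hY)

variable [T2Space M]

theorem isSmoothVF_leviCivita (hX : IsSmoothVF X) (hY : IsSmoothVF Y) :
    IsSmoothVF (fun x => leviCivita Y x (X x)) := by
  refine isSmoothVF_of_inner fun Z hZ => ?_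
  have h : (fun x => inner ℝ (Z x) (leviCivita Y x (X x))) = fun x => 1 / 2 * koszul X Y Z x := by
    funext x
    rw [real_inner_comm, inner_leviCivita (hX.mdifferentiableAt x) (hY.mdifferentiableAt x)
      (hZ.mdifferentiableAt x)]
  rw [h]
  exact contMDiff_const.mul (contMDiff_koszul hX hY hZ)

end LeviCivita

omit [RiemannianBundle (fun x : M => TangentSpace I x)] in
theorem contMDiffCovariantDerivative_of_apply [FiniteDimensional ℝ E] [T2Space M]
    {cov : CovariantDerivative I E (fun x : M => TangentSpace I x)}
    (h : ∀ X Y : Π x : M, TangentSpace I x, IsSmoothVF X → IsSmoothVF Y →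
      IsSmoothVF (fun x => cov Y x (X x))) :
    CovariantDerivative.ContMDiffCovariantDerivative cov ∞ := by
  refine ⟨⟨fun {Y} hY => ?_⟩⟩
  rw [contMDiffOn_univ] at hY ⊢
  exact isSmoothEnd_of_apply fun X hX => h X Y hX hY

end ContactGeometry

namespace ContactGeometry

/-! ### Linear algebra of almost 3-contact structures -/

theorem IsEvenPerm.rotate {i j k : Fin 3} (h : IsEvenPerm i j k) : IsEvenPerm j k i := by
  obtain ⟨rfl, rfl⟩ := h
  exact ⟨by revert i; decide, by revert i; decide⟩

theorem IsEvenPerm.eq_or {i j k : Fin 3} (h : IsEvenPerm i j k) (l : Fin 3) :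
    l = i ∨ l = j ∨ l = k := by
  obtain ⟨rfl, rfl⟩ := h
  revert i l; decide

theorem IsEvenPerm.ne {i j k : Fin 3} (h : IsEvenPerm i j k) : i ≠ j ∧ j ≠ k ∧ i ≠ k := by
  obtain ⟨rfl, rfl⟩ := h
  revert i; decide

theorem isEvenPerm_self (i : Fin 3) : IsEvenPerm i (i + 1) (i + 2) := ⟨rfl, rfl⟩

/-- The pointwise model of an almost 3-contact metric structure. -/
structure LinearThreeContact (V : Type*) [NormedAddCommGroup V] [InnerProductSpace ℝ V] where
  φ : Fin 3 → V →ₗ[ℝ] V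
  ξ : Fin 3 → V
  inner_ξ_self : ∀ i, inner ℝ (ξ i) (ξ i) = 1
  inner_ξ_ne : ∀ i j, i ≠ j → inner ℝ (ξ i) (ξ j) = 0
  φ_skew : ∀ i v w, inner ℝ (φ i v) w = - inner ℝ v (φ i w)
  φ_sq : ∀ i v, φ i (φ i v) = - v + inner ℝ v (ξ i) • ξ i
  φ_mul : ∀ i j k, IsEvenPerm i j k → ∀ v, φ i (φ j v) = φ k v + inner ℝ v (ξ j) • ξ i
  φ_mul' : ∀ i j k, IsEvenPerm i j k → ∀ v, φ j (φ i v) = - φ k v + inner ℝ v (ξ i) • ξ j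
  φ_ξ_self : ∀ i, φ i (ξ i) = 0
  φ_ξ : ∀ i j k, IsEvenPerm i j k → φ i (ξ j) = ξ k
  φ_ξ' : ∀ i j k, IsEvenPerm i j k → φ j (ξ i) = - ξ k

namespace LinearThreeContact

variable {V : Type*} [NormedAddCommGroup V] [InnerProductSpace ℝ V] (S : LinearThreeContact V)

/-- A vector orthogonal to the three Reeb vectors. -/
def IsHor (v : V) : Prop := ∀ i, inner ℝ v (S.ξ i) = 0

/-- The orthogonal projection to the horizontal space. -/
noncomputable def hor (v : V) : V := v - ∑ i, inner ℝ v (S.ξ i) • S.ξ i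

variable {S}

theorem inner_ξ (i j : Fin 3) : inner ℝ (S.ξ i) (S.ξ j) = if i = j then 1 else 0 := by
  split_ifs with h
  · subst h; exact S.inner_ξ_self i
  · exact S.inner_ξ_ne i j h

theorem hor_add (v w : V) : S.hor (v + w) = S.hor v + S.hor w := by
  simp only [hor, inner_add_left, add_smul, Finset.sum_add_distrib]
  abel

theorem hor_smul (c : ℝ) (v : V) : S.hor (c • v) = c • S.hor v := by
  simp only [hor, real_inner_smul_left, mul_smul, ← Finset.smul_sum, smul_sub]

theorem hor_ξ (i : Fin 3) : S.hor (S.ξ i) = 0 := by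
  simp [hor, inner_ξ]

theorem isHor_hor (v : V) : S.IsHor (S.hor v) := by
  intro i
  simp [hor, inner_sub_left, sum_inner, real_inner_smul_left, inner_ξ]

theorem IsHor.hor_eq {v : V} (hv : S.IsHor v) : S.hor v = v := by
  have h : ∀ i, inner ℝ v (S.ξ i) = 0 := hv
  simp [hor, h]

theorem isHor_φ {v : V} (hv : S.IsHor v) (i : Fin 3) : S.IsHor (S.φ i v) := by
  intro l
  have h := isEvenPerm_self i
  rw [S.φ_skew]
  rcases h.eq_or l with rfl | rfl | rfl
  · rw [S.φ_ξ_self, inner_zero_right, neg_zero]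
  · rw [S.φ_ξ _ _ _ h, hv, neg_zero]
  · rw [S.φ_ξ' _ _ _ h.rotate.rotate, inner_neg_right, hv, neg_zero, neg_zero]

theorem horizontal_induction {p : V → Prop} (hH : ∀ v, S.IsHor v → p v) (hξ : ∀ i, p (S.ξ i))
    (hadd : ∀ v w, p v → p w → p (v + w)) (hsmul : ∀ (c : ℝ) v, p v → p (c • v)) (v : V) : p v := by
  have h : v = S.hor v + (inner ℝ v (S.ξ 0) • S.ξ 0 + inner ℝ v (S.ξ 1) • S.ξ 1
      + inner ℝ v (S.ξ 2) • S.ξ 2) := by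
    simp [hor, Fin.sum_univ_three]
  rw [h]
  exact hadd _ _ (hH _ (isHor_hor v))
    (hadd _ _ (hadd _ _ (hsmul _ _ (hξ 0)) (hsmul _ _ (hξ 1))) (hsmul _ _ (hξ 2)))

theorem φ_sq_hor {v : V} (hv : S.IsHor v) (i : Fin 3) : S.φ i (S.φ i v) = - v := by
  rw [S.φ_sq, hv, zero_smul, add_zero]

variable (S) in
/-- The vertical volume form `η_1 ∧ η_2 ∧ η_3`. -/
noncomputable def vol (u v w : V) : ℝ :=
  inner ℝ u (S.ξ 0) * (inner ℝ v (S.ξ 1) * inner ℝ w (S.ξ 2)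
      - inner ℝ v (S.ξ 2) * inner ℝ w (S.ξ 1))
    + inner ℝ u (S.ξ 1) * (inner ℝ v (S.ξ 2) * inner ℝ w (S.ξ 0)
      - inner ℝ v (S.ξ 0) * inner ℝ w (S.ξ 2))
    + inner ℝ u (S.ξ 2) * (inner ℝ v (S.ξ 0) * inner ℝ w (S.ξ 1)
      - inner ℝ v (S.ξ 1) * inner ℝ w (S.ξ 0))

theorem vol_eq {i j k : Fin 3} (h : IsEvenPerm i j k) (u v w : V) :
    S.vol u v w = inner ℝ u (S.ξ i) * (inner ℝ v (S.ξ j) * inner ℝ w (S.ξ k)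
      - inner ℝ v (S.ξ k) * inner ℝ w (S.ξ j))
    + inner ℝ u (S.ξ j) * (inner ℝ v (S.ξ k) * inner ℝ w (S.ξ i)
      - inner ℝ v (S.ξ i) * inner ℝ w (S.ξ k))
    + inner ℝ u (S.ξ k) * (inner ℝ v (S.ξ i) * inner ℝ w (S.ξ j)
      - inner ℝ v (S.ξ j) * inner ℝ w (S.ξ i)) := by
  obtain ⟨rfl, rfl⟩ := h
  fin_cases i <;> simp [vol] <;> ring

end LinearThreeContact

/-- The pointwise model of a canonical almost 3-contact metric structure with its Levi-Civita
connection: `D i w u` stands for `(∇_u φ_i) w` and `P i u` for `∇_u ξ_i`. -/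
structure LinearCanonical (V : Type*) [NormedAddCommGroup V] [InnerProductSpace ℝ V] extends
    LinearThreeContact V where
  P : Fin 3 → V →ₗ[ℝ] V
  D : Fin 3 → V →ₗ[ℝ] V →ₗ[ℝ] V
  β : ℝ
  P_skew : ∀ i u v, inner ℝ (P i u) v = - inner ℝ (P i v) u
  P_ξ : ∀ i j u, inner ℝ (P i u) (ξ j) = - inner ℝ (P j u) (ξ i)
  D_skew : ∀ i u v w, inner ℝ (D i w u) v = - inner ℝ (D i v u) w
  D_φ : ∀ i u w, D i (φ i w) u + φ i (D i w u) = inner ℝ (P i u) w • ξ i + inner ℝ w (ξ i) • P i u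
  D_ξ_self : ∀ i u, D i (ξ i) u = - φ i (P i u)
  D_ξ : ∀ i j k, IsEvenPerm i j k → ∀ u, D i (ξ j) u = P k u - φ i (P j u)
  D_ξ' : ∀ i j k, IsEvenPerm i j k → ∀ u, D i (ξ k) u = - P j u - φ i (P k u)
  N_skew : ∀ i u v w, toLinearThreeContact.IsHor u → toLinearThreeContact.IsHor v →
    toLinearThreeContact.IsHor w →
    inner ℝ (D i w (φ i u) - D i u (φ i w) + φ i (D i u w) - φ i (D i w u)) v
      = - inner ℝ (D i v (φ i u) - D i u (φ i v) + φ i (D i u v) - φ i (D i v u)) w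
  N_sub_dΦ : ∀ i j u v w, toLinearThreeContact.IsHor u → toLinearThreeContact.IsHor v →
    toLinearThreeContact.IsHor w →
    inner ℝ (D i v (φ i u) - D i u (φ i v) + φ i (D i u v) - φ i (D i v u)) w
        - (inner ℝ (φ i v) (D i (φ i w) (φ i u)) + inner ℝ (φ i w) (D i (φ i u) (φ i v))
          + inner ℝ (φ i u) (D i (φ i v) (φ i w)))
      = inner ℝ (D j v (φ j u) - D j u (φ j v) + φ j (D j u v) - φ j (D j v u)) w
        - (inner ℝ (φ j v) (D j (φ j w) (φ j u)) + inner ℝ (φ j w) (D j (φ j u) (φ j v))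
          + inner ℝ (φ j u) (D j (φ j v) (φ j w)))
  A_self : ∀ i u v, toLinearThreeContact.IsHor u → toLinearThreeContact.IsHor v →
    inner ℝ (D i u (ξ i)) v + inner ℝ (P i (φ i u)) v + inner ℝ (P i u) (φ i v) = 0
  A_eq : ∀ i j k, IsEvenPerm i j k → ∀ u v, toLinearThreeContact.IsHor u →
    toLinearThreeContact.IsHor v →
    inner ℝ (D i u (ξ j)) v + inner ℝ (P j (φ i u)) v + inner ℝ (P j u) (φ i v)
      = β * inner ℝ u (φ k v)
  A_eq' : ∀ i j k, IsEvenPerm i j k → ∀ u v, toLinearThreeContact.IsHor u →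
    toLinearThreeContact.IsHor v →
    inner ℝ (D j u (ξ i)) v + inner ℝ (P i (φ j u)) v + inner ℝ (P i u) (φ j v)
      = - (β * inner ℝ u (φ k v))

namespace LinearCanonical

open LinearThreeContact

variable {V : Type*} [NormedAddCommGroup V] [InnerProductSpace ℝ V] (S : LinearCanonical V)

/-- The bilinear form agreeing with `dη_l` on horizontal vectors, halved on mixed pairs, and
vanishing on vertical ones. -/
noncomputable def q (l : Fin 3) (v w : V) : ℝ :=
  inner ℝ (S.P l (S.hor v)) w + inner ℝ (S.P l v) (S.hor w)

/-- The horizontal part of the torsion, `N_{φ_i} - dΦ_i(φ_i ·, φ_i ·, φ_i ·)`. -/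
noncomputable def τ (i : Fin 3) (u v w : V) : ℝ :=
  inner ℝ (S.φ i w) (S.D i v u) - inner ℝ (S.φ i w) (S.D i u v)
    + inner ℝ u (S.D i v (S.φ i w))

/-- The torsion `3`-form of the canonical connection. -/
noncomputable def torsion (u v w : V) : ℝ :=
  S.τ 0 (S.hor u) (S.hor v) (S.hor w)
    + ∑ l, (inner ℝ u (S.ξ l) * S.q l v w + inner ℝ v (S.ξ l) * S.q l w u
      + inner ℝ w (S.ξ l) * S.q l u v)
    + 2 * (S.β + inner ℝ (S.P 0 (S.ξ 1)) (S.ξ 2)) * S.vol u v w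

variable {S}

theorem q_skew (l : Fin 3) (v w : V) : S.q l v w = - S.q l w v := by
  simp only [q]
  rw [S.P_skew l (S.hor v) w, S.P_skew l v (S.hor w)]
  ring

/-- Differentiating `φ² = -1 + η ⊗ ξ` shows that `∇φ` and `φ` anticommute up to terms invisible to
horizontal vectors. -/
theorem inner_D_φ {i : Fin 3} {v w : V} (hv : S.IsHor v) (hw : S.IsHor w) (u : V) :
    inner ℝ v (S.D i (S.φ i w) u) = inner ℝ (S.φ i v) (S.D i w u) := by
  have h := congrArg (fun z => inner ℝ v z) (S.D_φ i u w)
  have h1 : inner ℝ v (S.ξ i) = 0 := hv i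
  have h2 : inner ℝ w (S.ξ i) = 0 := hw i
  simp only [inner_add_right, real_inner_smul_right, h1, h2] at h
  rw [S.φ_skew]
  linarith

theorem D_skew' (i : Fin 3) (u v w : V) : inner ℝ v (S.D i w u) = - inner ℝ w (S.D i v u) := by
  rw [real_inner_comm, S.D_skew, real_inner_comm]

/-- By `inner_D_φ` and `φ² = -1`, each term of `dΦ` sheds two factors `φ`; the terms differentiated
along `φu` and `φv` then cancel those of `N`, and three terms survive. The short form is used in
computations, the long one to import conditions 1 and 3. -/
theorem τ_eq {i : Fin 3} {u v w : V} (hu : S.IsHor u) (hv : S.IsHor v) (hw : S.IsHor w) :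
    S.τ i u v w =
      inner ℝ (S.D i v (S.φ i u) - S.D i u (S.φ i v) + S.φ i (S.D i u v) - S.φ i (S.D i v u)) w
        - (inner ℝ (S.φ i v) (S.D i (S.φ i w) (S.φ i u))
          + inner ℝ (S.φ i w) (S.D i (S.φ i u) (S.φ i v))
          + inner ℝ (S.φ i u) (S.D i (S.φ i v) (S.φ i w))) := by
  rw [inner_D_φ (isHor_φ hv i) hw, inner_D_φ (isHor_φ hw i) hu, inner_D_φ (isHor_φ hu i) hv,
    φ_sq_hor hu, φ_sq_hor hv, φ_sq_hor hw]
  simp only [inner_sub_left, inner_add_left, inner_neg_left, S.φ_skew, τ]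
  rw [real_inner_comm w (S.D i v (S.φ i u)), real_inner_comm w (S.D i u (S.φ i v)),
    real_inner_comm _ (S.D i u v), real_inner_comm _ (S.D i v u), D_skew' i (S.φ i u) v w]
  simp only [S.φ_skew]
  ring

end LinearCanonical

end ContactGeometry

/-! ### The canonical torsion form and the derivatives of the Reeb vectors -/

namespace ContactGeometry

namespace LinearCanonical

open LinearThreeContact

variable {V : Type*} [NormedAddCommGroup V] [InnerProductSpace ℝ V] {S : LinearCanonical V}

theorem τ_eq_τ {u v w : V} (hu : S.IsHor u) (hv : S.IsHor v) (hw : S.IsHor w) (i j : Fin 3) :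
    S.τ i u v w = S.τ j u v w := by
  rw [τ_eq hu hv hw, τ_eq hu hv hw]
  exact S.N_sub_dΦ i j u v w hu hv hw

theorem τ_swap_left (i : Fin 3) (u v w : V) : S.τ i v u w = - S.τ i u v w := by
  simp only [τ]
  rw [D_skew' i (S.φ i w) v u]
  ring

/-- Condition 1 handles the `N` part; the `dΦ` part is skew because each `∇_u φ_i` is a skew
endomorphism. -/
theorem τ_swap_right {i : Fin 3} {u v w : V} (hu : S.IsHor u) (hv : S.IsHor v) (hw : S.IsHor w) :
    S.τ i u w v = - S.τ i u v w := by
  rw [τ_eq hu hv hw, τ_eq hu hw hv, S.N_skew i u v w hu hv hw,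
    D_skew' i (S.φ i u) (S.φ i v) (S.φ i w), D_skew' i (S.φ i v) (S.φ i w) (S.φ i u),
    D_skew' i (S.φ i w) (S.φ i u) (S.φ i v)]
  ring

/-- On horizontal vectors the canonical connection parallelizes every `φ_i`. -/
theorem D_add_τ {i : Fin 3} {u v w : V} (hu : S.IsHor u) (hv : S.IsHor v) (hw : S.IsHor w) :
    inner ℝ v (S.D i w u) + 1 / 2 * (S.τ i u (S.φ i w) v + S.τ i u w (S.φ i v)) = 0 := by
  have hN := S.N_skew i u (S.φ i w) v hu (isHor_φ hw i) hv
  have h1 := D_skew' (S := S) i (S.φ i u) v (S.φ i w)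
  have h2 := inner_D_φ (S := S) (i := i) (isHor_φ hv i) hw u
  have h3 := D_skew' (S := S) i u w v
  have h4 := D_skew' (S := S) i (S.φ i v) u (S.φ i w)
  have h5 := D_skew' (S := S) i v u w
  simp only [φ_sq_hor hv, φ_sq_hor hw, inner_sub_left, inner_add_left, inner_neg_left, map_neg,
    S.φ_skew, τ] at hN h2 ⊢
  have hc : ∀ a b c, inner ℝ (S.D i a b) c = inner ℝ c (S.D i a b) := fun _ _ _ =>
    real_inner_comm _ _
  simp only [hc, S.φ_skew, inner_neg_right, inner_neg_left] at hN h1 h2 h4 ⊢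
  linarith

theorem vol_swap_left (u v w : V) : S.vol v u w = - S.vol u v w := by
  simp only [vol]; ring

theorem vol_swap_right (u v w : V) : S.vol u w v = - S.vol u v w := by
  simp only [vol]; ring

theorem torsion_swap_left (u v w : V) : S.torsion v u w = - S.torsion u v w := by
  have h := fun l => q_skew (S := S) l
  simp only [torsion, τ_swap_left 0 (S.hor u), vol_swap_left u]
  have hs : ∀ l, inner ℝ v (S.ξ l) * S.q l u w + inner ℝ u (S.ξ l) * S.q l w v
      + inner ℝ w (S.ξ l) * S.q l v u = - (inner ℝ u (S.ξ l) * S.q l v w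
      + inner ℝ v (S.ξ l) * S.q l w u + inner ℝ w (S.ξ l) * S.q l u v) := fun l => by
    linear_combination inner ℝ v (S.ξ l) * h l u w + inner ℝ u (S.ξ l) * h l w v
      + inner ℝ w (S.ξ l) * h l v u
  simp only [hs, Finset.sum_neg_distrib]
  ring

theorem torsion_swap_right (u v w : V) : S.torsion u w v = - S.torsion u v w := by
  have h := fun l => q_skew (S := S) l
  simp only [torsion, τ_swap_right (i := 0) (isHor_hor u) (isHor_hor v) (isHor_hor w),
    vol_swap_right u v w]
  have hs : ∀ l, inner ℝ u (S.ξ l) * S.q l w v + inner ℝ w (S.ξ l) * S.q l v u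
      + inner ℝ v (S.ξ l) * S.q l u w = - (inner ℝ u (S.ξ l) * S.q l v w
      + inner ℝ v (S.ξ l) * S.q l w u + inner ℝ w (S.ξ l) * S.q l u v) := fun l => by
    linear_combination inner ℝ v (S.ξ l) * h l u w + inner ℝ u (S.ξ l) * h l w v
      + inner ℝ w (S.ξ l) * h l v u
  simp only [hs, Finset.sum_neg_distrib]
  ring

theorem torsion_add (u u' v w : V) :
    S.torsion (u + u') v w = S.torsion u v w + S.torsion u' v w := by
  simp only [torsion, τ, q, vol, hor_add, map_add, LinearMap.add_apply, inner_add_left,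
    inner_add_right, Fin.sum_univ_three]
  ring

theorem torsion_smul (c : ℝ) (u v w : V) : S.torsion (c • u) v w = c * S.torsion u v w := by
  simp only [torsion, τ, q, vol, hor_smul, map_smul, LinearMap.smul_apply, real_inner_smul_left,
    real_inner_smul_right, Fin.sum_univ_three]
  ring

theorem torsion_add_right (u v w w' : V) :
    S.torsion u v (w + w') = S.torsion u v w + S.torsion u v w' := by
  have h (z : V) : S.torsion u v z = S.torsion z u v := by
    rw [torsion_swap_left u z v, torsion_swap_right]
  rw [h, h, h, torsion_add]

theorem torsion_smul_right (c : ℝ) (u v w : V) :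
    S.torsion u v (c • w) = c * S.torsion u v w := by
  have h (z : V) : S.torsion u v z = S.torsion z u v := by
    rw [torsion_swap_left u z v, torsion_swap_right]
  rw [h, h, torsion_smul]

theorem torsion_add_middle (u v v' w : V) :
    S.torsion u (v + v') w = S.torsion u v w + S.torsion u v' w := by
  rw [torsion_swap_left, torsion_add, torsion_swap_left u v, torsion_swap_left u v']
  ring

theorem torsion_smul_middle (c : ℝ) (u v w : V) :
    S.torsion u (c • v) w = c * S.torsion u v w := by
  rw [torsion_swap_left, torsion_smul, torsion_swap_left u v]
  ring

theorem τ_zero_middle (i : Fin 3) (u v : V) : S.τ i u 0 v = 0 := by simp [τ]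

theorem inner_P_self (i : Fin 3) (u : V) : inner ℝ (S.P i u) (S.ξ i) = 0 := by
  linarith [S.P_ξ i i u]

theorem inner_P_ξ_self (i : Fin 3) (u : V) : inner ℝ (S.P i (S.ξ i)) u = 0 := by
  rw [S.P_skew, inner_P_self, neg_zero]

theorem inner_P_ξ_ξ {i j k : Fin 3} (h : IsEvenPerm i j k) :
    inner ℝ (S.P i (S.ξ j)) (S.ξ k) = inner ℝ (S.P 0 (S.ξ 1)) (S.ξ 2) := by
  have h1 : ∀ i j k, inner ℝ (S.P i (S.ξ j)) (S.ξ k) = inner ℝ (S.P j (S.ξ k)) (S.ξ i) := by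
    intro i j k
    rw [S.P_skew, S.P_ξ, neg_neg]
  obtain ⟨rfl, rfl⟩ := h
  fin_cases i
  · rfl
  · exact (h1 0 1 2).symm
  · exact h1 2 0 1

theorem inner_P_ξ_ξ' {i j k : Fin 3} (h : IsEvenPerm i j k) :
    inner ℝ (S.P i (S.ξ k)) (S.ξ j) = - inner ℝ (S.P 0 (S.ξ 1)) (S.ξ 2) := by
  rw [S.P_skew, inner_P_ξ_ξ h]

/-- The Killing condition and orthonormality of the Reeb vectors make this expression skew in all
three indices, so on a 3-dimensional space it is a multiple of the volume form. -/
theorem inner_P_ξ_ξ_eq (i m n : Fin 3) : inner ℝ (S.P i (S.ξ m)) (S.ξ n)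
    = inner ℝ (S.P 0 (S.ξ 1)) (S.ξ 2) * S.vol (S.ξ i) (S.ξ m) (S.ξ n) := by
  have h := isEvenPerm_self i
  have hn := h.ne
  have hv := fun a b c => vol_eq (S := S.toLinearThreeContact) h a b c
  have nrm : ∀ l, ‖S.ξ l‖ = 1 := fun l => by
    rw [norm_eq_sqrt_real_inner, S.inner_ξ_self, Real.sqrt_one]
  rw [hv]
  rcases h.eq_or m with h1 | h1 | h1 <;> rcases h.eq_or n with h2 | h2 | h2 <;>
    rw [h1, h2] <;>
    simp [nrm, inner_ξ, inner_P_self, inner_P_ξ_self, inner_P_ξ_ξ h, inner_P_ξ_ξ' h, hn.1, hn.2.1,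
      hn.2.2, hn.1.symm, hn.2.1.symm, hn.2.2.symm, S.P_ξ i (i + 1) (S.ξ (i + 1)),
      S.P_ξ i (i + 2) (S.ξ (i + 2))]

/-- The derivative of the Reeb vectors under the canonical connection. -/
theorem P_add_torsion (i : Fin 3) (u v : V) :
    inner ℝ (S.P i u) v + 1 / 2 * S.torsion u (S.ξ i) v = - (S.β * S.vol (S.ξ i) u v) := by
  induction u using horizontal_induction (S := S.toLinearThreeContact) with
  | hadd u u' h h' =>
    have : ∀ v, S.vol (S.ξ i) (u + u') v = S.vol (S.ξ i) u v + S.vol (S.ξ i) u' v := by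
      intro v; simp only [vol, inner_add_left]; ring
    rw [torsion_add, map_add, inner_add_left, this]
    linarith
  | hsmul c u h =>
    have : S.vol (S.ξ i) (c • u) v = c * S.vol (S.ξ i) u v := by
      simp only [vol, real_inner_smul_left]; ring
    rw [torsion_smul, map_smul, real_inner_smul_left, this]
    linear_combination c * h
  | hH u hu =>
    have hu' : ∀ l, inner ℝ u (S.ξ l) = 0 := hu
    induction v using horizontal_induction (S := S.toLinearThreeContact) with
    | hadd v v' h h' =>
      have : S.vol (S.ξ i) u (v + v') = S.vol (S.ξ i) u v + S.vol (S.ξ i) u v' := by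
        simp only [vol, inner_add_left]; ring
      rw [torsion_add_right, inner_add_right, this]
      linarith
    | hsmul c v h =>
      have : S.vol (S.ξ i) u (c • v) = c * S.vol (S.ξ i) u v := by
        simp only [vol, real_inner_smul_left]; ring
      rw [torsion_smul_right, real_inner_smul_right, this]
      linear_combination c * h
    | hH v hv =>
      have hv' : ∀ l, inner ℝ v (S.ξ l) = 0 := hv
      simp [torsion, hor_ξ, τ_zero_middle, hu', hv', vol, inner_ξ, q, hu.hor_eq, hv.hor_eq]
      linarith [S.P_skew i u v]
    | hξ n =>
      -- With two Reeb arguments both `q i` and `q n` contribute, and equally. The halving of `q` on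
      -- mixed pairs prevents this from counting `dη` twice.
      simp [torsion, hor_ξ, τ_zero_middle, hu', vol, inner_ξ, q, hu.hor_eq, Finset.sum_add_distrib]
      linarith [S.P_skew i (S.ξ n) u, S.P_ξ i n u]
  | hξ m =>
    induction v using horizontal_induction (S := S.toLinearThreeContact) with
    | hadd v v' h h' =>
      have : S.vol (S.ξ i) (S.ξ m) (v + v') = S.vol (S.ξ i) (S.ξ m) v + S.vol (S.ξ i) (S.ξ m) v' := by
        simp only [vol, inner_add_left]; ring
      rw [torsion_add_right, inner_add_right, this]
      linarith
    | hsmul c v h =>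
      have : S.vol (S.ξ i) (S.ξ m) (c • v) = c * S.vol (S.ξ i) (S.ξ m) v := by
        simp only [vol, real_inner_smul_left]; ring
      rw [torsion_smul_right, real_inner_smul_right, this]
      linear_combination c * h
    | hH v hv =>
      have hv' : ∀ l, inner ℝ v (S.ξ l) = 0 := hv
      simp [torsion, hor_ξ, τ_zero_middle, hv', vol, inner_ξ, q, hv.hor_eq, Finset.sum_add_distrib]
      linarith [S.P_skew i (S.ξ m) v, S.P_ξ i m v, S.P_skew m (S.ξ i) v]
    | hξ n =>
      rw [inner_P_ξ_ξ_eq]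
      -- The vertical coefficient of `torsion` is fixed here: half of it removes the Levi-Civita
      -- contribution and leaves exactly `-β` times the volume form.
      have : S.torsion (S.ξ m) (S.ξ i) (S.ξ n) = - (2 * (S.β + inner ℝ (S.P 0 (S.ξ 1)) (S.ξ 2))
          * S.vol (S.ξ i) (S.ξ m) (S.ξ n)) := by
        simp [torsion, hor_ξ, τ_zero_middle, q, vol_swap_left (S := S) (S.ξ i) (S.ξ m)]
      rw [this]
      ring

end LinearCanonical

end ContactGeometry

/-! ### The 3-forms `η ∧ Φ` and their effect on `φ_a` -/

namespace ContactGeometry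

namespace LinearThreeContact

variable {V : Type*} [NormedAddCommGroup V] [InnerProductSpace ℝ V] {S : LinearThreeContact V}

theorem eq_zero_of_hor {f : V → ℝ} (hadd : ∀ v w, f (v + w) = f v + f w)
    (hsmul : ∀ (c : ℝ) v, f (c • v) = c * f v) (hξ : ∀ i, f (S.ξ i) = 0)
    (hH : ∀ v, S.IsHor v → f v = 0) (v : V) : f v = 0 :=
  horizontal_induction (p := fun v => f v = 0) hH hξ
    (fun v w h h' => by rw [hadd, h, h', add_zero]) (fun c v h => by rw [hsmul, h, mul_zero]) v

variable (S) in
/-- The `3`-form `η_b ∧ Φ_b` for `b = ∑ a_i e_i`. -/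
noncomputable def etaPhi (a : Fin 3 → ℝ) (u v w : V) : ℝ :=
  inner ℝ u (∑ i, a i • S.ξ i) * inner ℝ v (∑ i, a i • S.φ i w)
    + inner ℝ v (∑ i, a i • S.ξ i) * inner ℝ w (∑ i, a i • S.φ i u)
    + inner ℝ w (∑ i, a i • S.ξ i) * inner ℝ u (∑ i, a i • S.φ i v)

variable (S) in
/-- The `3`-form `∑ η_i ∧ Φ_i`. -/
noncomputable def sumEtaPhi (u v w : V) : ℝ :=
  ∑ i, (inner ℝ u (S.ξ i) * inner ℝ v (S.φ i w) + inner ℝ v (S.ξ i) * inner ℝ w (S.φ i u)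
    + inner ℝ w (S.ξ i) * inner ℝ u (S.φ i v))

theorem Φ_swap (i : Fin 3) (v w : V) : inner ℝ w (S.φ i v) = - inner ℝ v (S.φ i w) := by
  rw [real_inner_comm, S.φ_skew]

theorem etaPhi_swap_left (a : Fin 3 → ℝ) (u v w : V) : S.etaPhi a v u w = - S.etaPhi a u v w := by
  simp only [etaPhi, Fin.sum_univ_three, inner_add_right, real_inner_smul_right]
  rw [Φ_swap 0 v u, Φ_swap 1 v u, Φ_swap 2 v u, Φ_swap 0 w u, Φ_swap 1 w u, Φ_swap 2 w u,
    Φ_swap 0 w v, Φ_swap 1 w v, Φ_swap 2 w v]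
  ring

theorem etaPhi_swap_right (a : Fin 3 → ℝ) (u v w : V) : S.etaPhi a u w v = - S.etaPhi a u v w := by
  simp only [etaPhi, Fin.sum_univ_three, inner_add_right, real_inner_smul_right]
  rw [Φ_swap 0 v u, Φ_swap 1 v u, Φ_swap 2 v u, Φ_swap 0 w u, Φ_swap 1 w u, Φ_swap 2 w u,
    Φ_swap 0 w v, Φ_swap 1 w v, Φ_swap 2 w v]
  ring

theorem sumEtaPhi_swap_left (u v w : V) : S.sumEtaPhi v u w = - S.sumEtaPhi u v w := by
  simp only [sumEtaPhi, Fin.sum_univ_three]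
  rw [Φ_swap 0 v u, Φ_swap 1 v u, Φ_swap 2 v u, Φ_swap 0 w u, Φ_swap 1 w u, Φ_swap 2 w u,
    Φ_swap 0 w v, Φ_swap 1 w v, Φ_swap 2 w v]
  ring

theorem sumEtaPhi_swap_right (u v w : V) : S.sumEtaPhi u w v = - S.sumEtaPhi u v w := by
  simp only [sumEtaPhi, Fin.sum_univ_three]
  rw [Φ_swap 0 v u, Φ_swap 1 v u, Φ_swap 2 v u, Φ_swap 0 w u, Φ_swap 1 w u, Φ_swap 2 w u,
    Φ_swap 0 w v, Φ_swap 1 w v, Φ_swap 2 w v]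
  ring

theorem etaPhi_add (a : Fin 3 → ℝ) (u u' v w : V) :
    S.etaPhi a (u + u') v w = S.etaPhi a u v w + S.etaPhi a u' v w := by
  simp only [etaPhi, inner_add_left, map_add, smul_add, Finset.sum_add_distrib, inner_add_right]
  ring

theorem etaPhi_smul (a : Fin 3 → ℝ) (c : ℝ) (u v w : V) :
    S.etaPhi a (c • u) v w = c * S.etaPhi a u v w := by
  simp only [etaPhi, real_inner_smul_left, map_smul, smul_comm (a _) c, ← Finset.smul_sum,
    real_inner_smul_right]
  ring

theorem sumEtaPhi_add (u u' v w : V) :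
    S.sumEtaPhi (u + u') v w = S.sumEtaPhi u v w + S.sumEtaPhi u' v w := by
  simp only [sumEtaPhi, inner_add_left, map_add, inner_add_right, Fin.sum_univ_three]
  ring

theorem sumEtaPhi_smul (c : ℝ) (u v w : V) :
    S.sumEtaPhi (c • u) v w = c * S.sumEtaPhi u v w := by
  simp only [sumEtaPhi, real_inner_smul_left, map_smul, real_inner_smul_right, Fin.sum_univ_three]
  ring

/-- The left side is the change of `∇_u φ_a` caused by adding the form to the torsion. Relative to
an orthonormal basis `a, b, c` of `ℝ³` the form is `η_b ∧ Φ_b + η_c ∧ Φ_c`, and the commutators of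
`φ_a` with `φ_b` and `φ_c` are multiples of `φ_c` and `φ_b` up to vertical terms. What results is
the negative of the infinitesimal rotation of `φ_a`. -/
theorem sumEtaPhi_sub_etaPhi {a : Fin 3 → ℝ} (ha : a 0 ^ 2 + a 1 ^ 2 + a 2 ^ 2 = 1) (u v w : V) :
    1 / 2 * (S.sumEtaPhi u (∑ l, a l • S.φ l w) v - S.etaPhi a u (∑ l, a l • S.φ l w) v
      + (S.sumEtaPhi u w (∑ l, a l • S.φ l v) - S.etaPhi a u w (∑ l, a l • S.φ l v)))
    = - (a 0 * (inner ℝ u (S.ξ 2) * inner ℝ v (S.φ 1 w) - inner ℝ u (S.ξ 1) * inner ℝ v (S.φ 2 w))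
      + a 1 * (inner ℝ u (S.ξ 0) * inner ℝ v (S.φ 2 w) - inner ℝ u (S.ξ 2) * inner ℝ v (S.φ 0 w))
      + a 2 * (inner ℝ u (S.ξ 1) * inner ℝ v (S.φ 0 w)
        - inner ℝ u (S.ξ 0) * inner ℝ v (S.φ 1 w))) := by
  have e0 : IsEvenPerm 0 1 2 := ⟨rfl, rfl⟩
  have e1 : IsEvenPerm 1 2 0 := ⟨rfl, rfl⟩
  have e2 : IsEvenPerm 2 0 1 := ⟨rfl, rfl⟩
  simp only [sumEtaPhi, etaPhi, Fin.sum_univ_three, map_add, map_smul, inner_add_left,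
    inner_add_right, real_inner_smul_left, real_inner_smul_right, S.φ_skew, S.φ_ξ_self,
    S.φ_ξ _ _ _ e0, S.φ_ξ _ _ _ e1, S.φ_ξ _ _ _ e2, S.φ_ξ' _ _ _ e0, S.φ_ξ' _ _ _ e1,
    S.φ_ξ' _ _ _ e2, S.φ_sq, S.φ_mul _ _ _ e0, S.φ_mul _ _ _ e1, S.φ_mul _ _ _ e2,
    S.φ_mul' _ _ _ e0, S.φ_mul' _ _ _ e1, S.φ_mul' _ _ _ e2, inner_neg_right, inner_zero_right]
  rw [Φ_swap 0 v w, Φ_swap 1 v w, Φ_swap 2 v w]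
  -- Unit length enters only here: `η_a ∧ Φ_a` produces `|a|² g(u,w) η_a(v)` and its swap in `v, w`
  -- through `φ_a²`, to be matched with the same terms without `|a|²` from the full sum.
  linear_combination (1 / 2 * (inner ℝ u w * (a 0 * inner ℝ v (S.ξ 0) + a 1 * inner ℝ v (S.ξ 1)
    + a 2 * inner ℝ v (S.ξ 2)) - inner ℝ v u * (a 0 * inner ℝ w (S.ξ 0) + a 1 * inner ℝ w (S.ξ 1)
    + a 2 * inner ℝ w (S.ξ 2)))) * ha

end LinearThreeContact

end ContactGeometry

/-! ### The canonical connection rotates the structure tensors -/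

namespace ContactGeometry

namespace LinearCanonical

open LinearThreeContact

variable {V : Type*} [NormedAddCommGroup V] [InnerProductSpace ℝ V] {S : LinearCanonical V}

variable (S) in
/-- The failure of `∇φ_i = β (η_k ⊗ φ_j - η_j ⊗ φ_k)` for the canonical connection `∇`. -/
noncomputable def defect (i j k : Fin 3) (u v w : V) : ℝ :=
  inner ℝ v (S.D i w u) + 1 / 2 * (S.torsion u (S.φ i w) v + S.torsion u w (S.φ i v))
    - S.β * (inner ℝ u (S.ξ k) * inner ℝ v (S.φ j w) - inner ℝ u (S.ξ j) * inner ℝ v (S.φ k w))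

theorem defect_swap (i j k : Fin 3) (u v w : V) : S.defect i j k u w v = - S.defect i j k u v w := by
  simp only [defect]
  rw [D_skew' i u w v, torsion_swap_right u v (S.φ i w), torsion_swap_right u (S.φ i v) w,
    Φ_swap j v w, Φ_swap k v w]
  ring

theorem defect_add (i j k : Fin 3) (u u' v w : V) :
    S.defect i j k (u + u') v w = S.defect i j k u v w + S.defect i j k u' v w := by
  simp only [defect, map_add, torsion_add, inner_add_left, inner_add_right]
  ring

theorem defect_smul (i j k : Fin 3) (c : ℝ) (u v w : V) :
    S.defect i j k (c • u) v w = c * S.defect i j k u v w := by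
  simp only [defect, map_smul, torsion_smul, real_inner_smul_left, real_inner_smul_right]
  ring

theorem defect_add_middle (i j k : Fin 3) (u v v' w : V) :
    S.defect i j k u (v + v') w = S.defect i j k u v w + S.defect i j k u v' w := by
  simp only [defect, map_add, torsion_add_right, inner_add_left]
  ring

theorem defect_smul_middle (i j k : Fin 3) (c : ℝ) (u v w : V) :
    S.defect i j k u (c • v) w = c * S.defect i j k u v w := by
  simp only [defect, map_smul, torsion_smul_right, real_inner_smul_left]
  ring

/-- A rearrangement of `P_add_torsion`, used to eliminate the torsion whenever a Reeb vector is
inserted. -/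
theorem torsion_ξ_right (i : Fin 3) (u v : V) :
    S.torsion u (S.ξ i) v = - 2 * (S.β * S.vol (S.ξ i) u v) - 2 * inner ℝ (S.P i u) v := by
  linarith [P_add_torsion (S := S) i u v]

theorem torsion_ξ_left (i : Fin 3) {u v : V} (hu : S.IsHor u) :
    S.torsion (S.ξ i) u v = 2 * inner ℝ (S.P i u) v := by
  have hu' : ∀ l, inner ℝ u (S.ξ l) = 0 := hu
  rw [torsion_swap_left, torsion_ξ_right, vol_swap_left]
  simp only [vol, hu']
  ring

/-- Since `φ_i ξ_l` is zero or plus or minus another Reeb vector, `(∇_u φ_i) ξ_l` is determined by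
the derivatives of the Reeb vectors, whose law is already known. -/
theorem defect_ξ {i j k : Fin 3} (h : IsEvenPerm i j k) (l : Fin 3) (u v : V) :
    S.defect i j k u v (S.ξ l) = 0 := by
  have hij := h.ne.1
  have hjk := h.ne.2.1
  have hik := h.ne.2.2
  have hP : ∀ l, inner ℝ v (S.φ i (S.P l u)) = - inner ℝ (S.P l u) (S.φ i v) :=
    fun l => Φ_swap i (S.P l u) v
  have hc : ∀ l, inner ℝ v (S.P l u) = inner ℝ (S.P l u) v := fun l => real_inner_comm _ _
  have h0 : ∀ w, S.torsion u 0 w = 0 := fun w => by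
    simpa using torsion_smul_middle (S := S) 0 u 0 w
  have hn : ∀ w w', S.torsion u (-w) w' = - S.torsion u w w' := fun w w' => by
    simpa using torsion_smul_middle (S := S) (-1) u w w'
  rcases h.eq_or l with rfl | rfl | rfl
  · simp only [defect, S.D_ξ_self, S.φ_ξ_self, S.φ_ξ' _ _ _ h, S.φ_ξ _ _ _ h.rotate.rotate,
      torsion_ξ_right, vol_eq h, inner_ξ, hij, hik, S.φ_skew, h0,
      S.φ_ξ' _ _ _ h.rotate.rotate, S.φ_ξ _ _ _ h, inner_neg_right, hP, if_true, if_false]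
    ring
  · simp only [defect, S.D_ξ _ _ _ h, S.φ_ξ_self, S.φ_ξ' _ _ _ h.rotate,
      torsion_ξ_right, vol_eq h, inner_ξ, hjk, hij.symm, hjk.symm, hik.symm, S.φ_skew,
      S.φ_ξ' _ _ _ h.rotate.rotate, S.φ_ξ _ _ _ h, inner_neg_right, inner_sub_right, hP, hc,
      if_true, if_false, inner_zero_right]
    ring
  · simp only [defect, S.D_ξ' _ _ _ h, S.φ_ξ_self, S.φ_ξ' _ _ _ h.rotate.rotate,
      torsion_ξ_right, vol_eq h, inner_ξ, hjk, hij.symm, hjk.symm, hik.symm, S.φ_skew, hn,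
      S.φ_ξ _ _ _ h.rotate, S.φ_ξ _ _ _ h, inner_neg_right, inner_sub_right, hP, hc,
      if_true, if_false, inner_zero_right]
    ring

/-- Along `ξ_l` the torsion terms become derivatives of `ξ_l`, and the sum is `A_{il}`; condition 4
says that it equals the required multiple of `β`. -/
theorem defect_ξ_left {i j k : Fin 3} (h : IsEvenPerm i j k) (l : Fin 3) {v w : V}
    (hv : S.IsHor v) (hw : S.IsHor w) : S.defect i j k (S.ξ l) v w = 0 := by
  have hij := h.ne.1
  have hjk := h.ne.2.1
  have hik := h.ne.2.2
  simp only [defect, torsion_ξ_left l (isHor_φ hw i), torsion_ξ_left l hw]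
  rw [real_inner_comm (S.D i w (S.ξ l)) v]
  rcases h.eq_or l with rfl | rfl | rfl
  · simp only [inner_ξ, hij, hik, if_false]
    linarith [S.A_self l w v hw hv]
  · simp only [inner_ξ, hjk, if_false, if_true]
    rw [Φ_swap k w v]
    linarith [S.A_eq i l k h w v hw hv]
  · simp only [inner_ξ, hjk.symm, if_false, if_true]
    rw [Φ_swap j w v]
    linarith [S.A_eq' l i j h.rotate.rotate w v hw hv]

/-- The torsion is built from `τ 0`; condition 3 lets it be replaced by `τ i`, for which `D_add_τ`
applies. -/
theorem defect_hor {i j k : Fin 3} {u v w : V} (hu : S.IsHor u) (hv : S.IsHor v)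
    (hw : S.IsHor w) : S.defect i j k u v w = 0 := by
  have ht : ∀ {v w}, S.IsHor v → S.IsHor w → S.torsion u v w = S.τ i u v w := by
    intro v w hv hw
    have hu' : ∀ l, inner ℝ u (S.ξ l) = 0 := hu
    have hv' : ∀ l, inner ℝ v (S.ξ l) = 0 := hv
    have hw' : ∀ l, inner ℝ w (S.ξ l) = 0 := hw
    rw [τ_eq_τ hu hv hw i 0]
    simp [torsion, hu', hv', hw', vol, hu.hor_eq, hv.hor_eq, hw.hor_eq]
  have hu' : ∀ l, inner ℝ u (S.ξ l) = 0 := hu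
  simp only [defect, hu', ht (isHor_φ hw i) hv, ht hw (isHor_φ hv i)]
  linarith [D_add_τ (S := S) (i := i) hu hv hw]

/-- The defect is linear in `u` and `v` and skew in `v, w`, so it can be tested on Reeb and
horizontal vectors: first a Reeb vector among the last two slots, then in the first slot, then none.
-/
theorem defect_eq_zero {i j k : Fin 3} (h : IsEvenPerm i j k) (u v w : V) :
    S.defect i j k u v w = 0 := by
  refine eq_zero_of_hor (S := S.toLinearThreeContact) (f := fun v => S.defect i j k u v w)
    (fun v v' => defect_add_middle ..) (fun c v => defect_smul_middle ..) (fun l => ?_)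
    (fun v hv => ?_) v
  · rw [defect_swap, defect_ξ h, neg_zero]
  rw [← neg_eq_zero, ← defect_swap]
  refine eq_zero_of_hor (S := S.toLinearThreeContact) (f := fun w => S.defect i j k u w v)
    (fun v v' => defect_add_middle ..) (fun c v => defect_smul_middle ..) (fun l => ?_)
    (fun w hw => ?_) w
  · rw [defect_swap, defect_ξ h, neg_zero]
  exact eq_zero_of_hor (S := S.toLinearThreeContact) (f := fun u => S.defect i j k u w v)
    (fun v v' => defect_add ..) (fun c v => defect_smul ..) (fun l => defect_ξ_left h l hw hv)
    (fun u hu => defect_hor hu hw hv) u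

/-! ### The torsion of the characteristic connections -/

variable (S) in
/-- The torsion `3`-form of the characteristic connection of the structure `(φ_a, ξ_a, η_a)`. -/
noncomputable def charTorsion (a : Fin 3 → ℝ) (u v w : V) : ℝ :=
  S.torsion u v w + S.β * (S.sumEtaPhi u v w - S.etaPhi a u v w)

theorem charTorsion_swap_left (a : Fin 3 → ℝ) (u v w : V) :
    S.charTorsion a v u w = - S.charTorsion a u v w := by
  simp only [charTorsion]
  rw [torsion_swap_left u v, sumEtaPhi_swap_left u v, etaPhi_swap_left a u v]
  ring

theorem charTorsion_swap_right (a : Fin 3 → ℝ) (u v w : V) :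
    S.charTorsion a u w v = - S.charTorsion a u v w := by
  simp only [charTorsion]
  rw [torsion_swap_right u v, sumEtaPhi_swap_right u v, etaPhi_swap_right a u v]
  ring

theorem charTorsion_add (a : Fin 3 → ℝ) (u u' v w : V) :
    S.charTorsion a (u + u') v w = S.charTorsion a u v w + S.charTorsion a u' v w := by
  simp only [charTorsion, torsion_add, sumEtaPhi_add, etaPhi_add]
  ring

theorem charTorsion_smul (a : Fin 3 → ℝ) (c : ℝ) (u v w : V) :
    S.charTorsion a (c • u) v w = c * S.charTorsion a u v w := by
  simp only [charTorsion, torsion_smul, sumEtaPhi_smul, etaPhi_smul]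
  ring

theorem charTorsion_add_middle (a : Fin 3 → ℝ) (u v v' w : V) :
    S.charTorsion a u (v + v') w = S.charTorsion a u v w + S.charTorsion a u v' w := by
  rw [charTorsion_swap_left, charTorsion_add, charTorsion_swap_left a u v,
    charTorsion_swap_left a u v']
  ring

theorem charTorsion_smul_middle (a : Fin 3 → ℝ) (c : ℝ) (u v w : V) :
    S.charTorsion a u (c • v) w = c * S.charTorsion a u v w := by
  rw [charTorsion_swap_left, charTorsion_smul, charTorsion_swap_left a u v]
  ring

theorem charTorsion_add_right (a : Fin 3 → ℝ) (u v w w' : V) :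
    S.charTorsion a u v (w + w') = S.charTorsion a u v w + S.charTorsion a u v w' := by
  rw [charTorsion_swap_right, charTorsion_add_middle, charTorsion_swap_right a u v w,
    charTorsion_swap_right a u v w']
  ring

theorem charTorsion_smul_right (a : Fin 3 → ℝ) (c : ℝ) (u v w : V) :
    S.charTorsion a u v (c • w) = c * S.charTorsion a u v w := by
  rw [charTorsion_swap_right, charTorsion_smul_middle, charTorsion_swap_right a u v w]
  ring

/-- The structure `φ_a` is parallel for the connection with torsion `charTorsion a`. -/
theorem D_add_charTorsion {a : Fin 3 → ℝ} (ha : a 0 ^ 2 + a 1 ^ 2 + a 2 ^ 2 = 1) (u v w : V) :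
    inner ℝ v (∑ l, a l • S.D l w u) + 1 / 2 * (S.charTorsion a u (∑ l, a l • S.φ l w) v
      + S.charTorsion a u w (∑ l, a l • S.φ l v)) = 0 := by
  have h0 := defect_eq_zero (S := S) (i := 0) (j := 1) (k := 2) ⟨rfl, rfl⟩ u v w
  have h1 := defect_eq_zero (S := S) (i := 1) (j := 2) (k := 0) ⟨rfl, rfl⟩ u v w
  have h2 := defect_eq_zero (S := S) (i := 2) (j := 0) (k := 1) ⟨rfl, rfl⟩ u v w
  have h := sumEtaPhi_sub_etaPhi (S := S.toLinearThreeContact) ha u v w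
  simp only [charTorsion]
  simp only [defect] at h0 h1 h2
  have e1 : S.torsion u (∑ l, a l • S.φ l w) v = a 0 * S.torsion u (S.φ 0 w) v
      + a 1 * S.torsion u (S.φ 1 w) v + a 2 * S.torsion u (S.φ 2 w) v := by
    simp only [Fin.sum_univ_three, torsion_add_middle, torsion_smul_middle]
  have e2 : S.torsion u w (∑ l, a l • S.φ l v) = a 0 * S.torsion u w (S.φ 0 v)
      + a 1 * S.torsion u w (S.φ 1 v) + a 2 * S.torsion u w (S.φ 2 v) := by
    simp only [Fin.sum_univ_three, torsion_add_right, torsion_smul_right]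
  have e3 : inner ℝ v (∑ l, a l • S.D l w u) = a 0 * inner ℝ v (S.D 0 w u)
      + a 1 * inner ℝ v (S.D 1 w u) + a 2 * inner ℝ v (S.D 2 w u) := by
    simp only [Fin.sum_univ_three, inner_add_right, real_inner_smul_right]
  rw [e1, e2, e3]
  -- The combination with weights `a_i` of the three rotation laws leaves a `β`-term, which `h`
  -- cancels.
  linear_combination a 0 * h0 + a 1 * h1 + a 2 * h2 + S.β * h

end LinearCanonical

end ContactGeometry

namespace ContactGeometry

variable {E : Type*} [NormedAddCommGroup E] [NormedSpace ℝ E] [FiniteDimensional ℝ E]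
  {H : Type*} [TopologicalSpace H] {I : ModelWithCorners ℝ E H}
  {M : Type*} [TopologicalSpace M] [ChartedSpace H M] [IsManifold I ∞ M]
  [RiemannianBundle (fun x : M => TangentSpace I x)]
  [IsContMDiffRiemannianBundle I ∞ E (fun x : M => TangentSpace I x)]

/-! ### The Levi-Civita derivative of tensor fields -/

section CovEnd

variable {φ : Π x : M, TangentSpace I x →L[ℝ] TangentSpace I x}
  {X Y Z W W' : Π x : M, TangentSpace I x} {x : M} {f : M → ℝ}

omit [FiniteDimensional ℝ E] [RiemannianBundle (fun x : M => TangentSpace I x)]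
  [IsContMDiffRiemannianBundle I ∞ E (fun x : M => TangentSpace I x)] in
theorem IsSmoothEnd.mdifferentiableAt_apply (hφ : IsSmoothEnd φ) (hW : MDiffAt (T% W) x) :
    MDiffAt (T% (fun y => φ y (W y))) x :=
  MDifferentiableAt.clm_bundle_apply (F₁ := E) (F₂ := E)
    (ContMDiff.mdifferentiable hφ (by simp) x) hW

theorem leviCivita_add (hW : MDiffAt (T% W) x) (hW' : MDiffAt (T% W') x) :
    leviCivita (fun y => W y + W' y) x = leviCivita W x + leviCivita W' x :=
  leviCivita.isCovariantDerivativeOn.add hW hW'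

theorem leviCivita_smul (hf : MDiffAt f x) (hW : MDiffAt (T% W) x) (u : TangentSpace I x) :
    leviCivita (fun y => f y • W y) x u = f x • leviCivita W x u + mvfderiv I f x u • W x := by
  have h := leviCivita.isCovariantDerivativeOn.leibniz hW hf
  exact congrArg (fun A => A u) h

theorem leviCivita_neg (hW : MDiffAt (T% W) x) :
    leviCivita (fun y => - W y) x = - leviCivita W x := by
  have h := leviCivita.isCovariantDerivativeOn.smul_const (-1) hW
  simp only [neg_smul, one_smul] at h
  exact h

variable (x) in
/-- The operation `W ↦ (∇φ) W` at `x`. -/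
noncomputable def covEndFun (φ : Π x : M, TangentSpace I x →L[ℝ] TangentSpace I x)
    (W : Π x : M, TangentSpace I x) : TangentSpace I x →L[ℝ] TangentSpace I x :=
  leviCivita (fun y => φ y (W y)) x - φ x ∘L leviCivita W x

theorem tensorialAt_covEndFun (hφ : IsSmoothEnd φ) (x : M) :
    TensorialAt I E (covEndFun x φ) x where
  smul {f W} hf hW := by
    ext u
    have h1 := leviCivita_smul hf (hφ.mdifferentiableAt_apply hW) u
    have h2 := leviCivita_smul hf hW u
    have h3 : (fun y => φ y ((f • W) y)) = fun y => f y • φ y (W y) := by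
      funext y; simp
    have h4 : f • W = fun y => f y • W y := rfl
    rw [covEndFun, covEndFun, h3, h4]
    simp only [sub_apply, smul_apply, ContinuousLinearMap.comp_apply, h1, h2, map_add, map_smul]
    module
  add {W W'} hW hW' := by
    have h1 := leviCivita_add (hφ.mdifferentiableAt_apply hW) (hφ.mdifferentiableAt_apply hW')
    have h2 := leviCivita_add hW hW'
    have h3 : (fun y => φ y ((W + W') y)) = fun y => φ y (W y) + φ y (W' y) := by
      funext y; simp
    have h4 : W + W' = fun y => W y + W' y := rfl
    rw [covEndFun, covEndFun, covEndFun, h3, h4, h1, h2, ContinuousLinearMap.comp_add]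
    abel

/-- The Levi-Civita derivative of an endomorphism field; `covEnd hφ x w u` is `(∇_u φ) w`. -/
noncomputable def covEnd (hφ : IsSmoothEnd φ) (x : M) :
    TangentSpace I x →L[ℝ] TangentSpace I x →L[ℝ] TangentSpace I x :=
  TensorialAt.mkHom (covEndFun x φ) x (tensorialAt_covEndFun hφ x)

theorem leviCivita_end_apply (hφ : IsSmoothEnd φ) (hW : MDiffAt (T% W) x) (u : TangentSpace I x) :
    leviCivita (fun y => φ y (W y)) x u = covEnd hφ x (W x) u + φ x (leviCivita W x u) := by
  rw [covEnd, TensorialAt.mkHom_apply _ hW, covEndFun, sub_apply, ContinuousLinearMap.comp_apply,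
    sub_add_cancel]

theorem covEnd_apply (hφ : IsSmoothEnd φ) (hW : MDiffAt (T% W) x) (u : TangentSpace I x) :
    covEnd hφ x (W x) u = leviCivita (fun y => φ y (W y)) x u - φ x (leviCivita W x u) := by
  rw [leviCivita_end_apply hφ hW, add_sub_cancel_right]

theorem mlieBracket_eq (hX : MDiffAt (T% X) x) (hY : MDiffAt (T% Y) x) :
    mlieBracket I X Y x = leviCivita Y x (X x) - leviCivita X x (Y x) :=
  (leviCivita_sub_swap hX hY).symm

theorem lieDerivEnd_eq (hφ : IsSmoothEnd φ) (hX : MDiffAt (T% X) x) (hY : MDiffAt (T% Y) x) :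
    lieDerivEnd X φ Y x = covEnd hφ x (Y x) (X x) - leviCivita X x (φ x (Y x))
      + φ x (leviCivita X x (Y x)) := by
  rw [lieDerivEnd, mlieBracket_eq hX (hφ.mdifferentiableAt_apply hY), mlieBracket_eq hX hY,
    leviCivita_end_apply hφ hY, map_sub]
  abel

theorem IsKilling.inner_leviCivita_add [T2Space M] {ξ : Π x : M, TangentSpace I x}
    (h : IsKilling ξ) (x : M) (u v : TangentSpace I x) :
    inner ℝ (leviCivita ξ x u) v = - inner ℝ (leviCivita ξ x v) u := by
  obtain ⟨X, hX, rfl⟩ := exists_isSmoothVF_apply_eq x u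
  obtain ⟨Y, hY, rfl⟩ := exists_isSmoothVF_apply_eq x v
  have h1 := h.2 X Y hX hY x
  have hX' := hX.mdifferentiableAt x
  have hY' := hY.mdifferentiableAt x
  have hξ := h.1.mdifferentiableAt x
  rw [mvfderiv_inner_leviCivita hX' hY', mlieBracket_eq hξ hX', mlieBracket_eq hξ hY',
    inner_sub_left, inner_sub_right] at h1
  rw [real_inner_comm (X x)]
  linarith

end CovEnd

namespace AlmostContactMetricStructure

variable (S : AlmostContactMetricStructure I M)
  {X Y Z : Π x : M, TangentSpace I x} {x : M}

theorem mvfderiv_η (hY : MDiffAt (T% Y) x) (u : TangentSpace I x) :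
    mvfderiv I (fun y => S.η y (Y y)) x u
      = S.η x (leviCivita Y x u) + inner ℝ (Y x) (leviCivita S.ξ x u) := by
  have h : (fun y => S.η y (Y y)) = fun y => inner ℝ (Y y) (S.ξ y) :=
    funext fun y => (inner_ξ y _).symm
  rw [h, mvfderiv_inner_leviCivita hY (S.smooth_ξ.mdifferentiableAt x), inner_ξ]

theorem dOneForm_η (hX : MDiffAt (T% X) x) (hY : MDiffAt (T% Y) x) :
    dOneForm S.η X Y x
      = inner ℝ (Y x) (leviCivita S.ξ x (X x)) - inner ℝ (X x) (leviCivita S.ξ x (Y x)) := by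
  rw [dOneForm, S.mvfderiv_η hY, S.mvfderiv_η hX, mlieBracket_eq hX hY, map_sub]
  ring

theorem covEnd_skew (hX : MDiffAt (T% X) x) (hY : MDiffAt (T% Y) x) (u : TangentSpace I x) :
    inner ℝ (covEnd S.smooth_φ x (X x) u) (Y x) = - inner ℝ (covEnd S.smooth_φ x (Y x) u) (X x) := by
  have h : (fun y => inner ℝ (S.φ y (X y)) (Y y)) = - fun y => inner ℝ (S.φ y (Y y)) (X y) := by
    funext y
    rw [Pi.neg_apply, inner_φ_left, real_inner_comm]
  have h1 := mvfderiv_inner_leviCivita (S.smooth_φ.mdifferentiableAt_apply hX) hY u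
  have h2 := mvfderiv_inner_leviCivita (S.smooth_φ.mdifferentiableAt_apply hY) hX u
  rw [h, mvfderiv_neg, neg_apply, h2] at h1
  rw [covEnd_apply S.smooth_φ hX, covEnd_apply S.smooth_φ hY, inner_sub_left, inner_sub_left,
    inner_φ_left, inner_φ_left, real_inner_comm (S.φ x (Y x)), real_inner_comm (S.φ x (X x))]
  linarith

/-- This is the Levi-Civita derivative of `φ² = -1 + η ⊗ ξ`. -/
theorem covEnd_φ (hX : MDiffAt (T% X) x) (u : TangentSpace I x) :
    covEnd S.smooth_φ x (S.φ x (X x)) u + S.φ x (covEnd S.smooth_φ x (X x) u)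
      = inner ℝ (X x) (leviCivita S.ξ x u) • S.ξ x + S.η x (X x) • leviCivita S.ξ x u := by
  have hφX := S.smooth_φ.mdifferentiableAt_apply hX
  have hξ := S.smooth_ξ.mdifferentiableAt x
  have hη : MDiffAt (fun y => S.η y (X y)) x := by
    have h : (fun y => S.η y (X y)) = fun y => inner ℝ (X y) (S.ξ y) :=
      funext fun y => (inner_ξ y _).symm
    rw [h]
    exact mdifferentiableAt_inner hX hξ
  have h : (fun y => S.φ y (S.φ y (X y))) = fun y => - X y + S.η y (X y) • S.ξ y :=
    funext fun y => S.φ_sq y _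
  have h1 := leviCivita_end_apply S.smooth_φ hφX u
  have hs : MDiffAt (T% fun y => S.η y (X y) • S.ξ y) x := hη.smul_section hξ
  have hn : MDiffAt (T% fun y => - X y) x := mdifferentiableAt_neg_section hX
  rw [h, leviCivita_add hn hs, add_apply, leviCivita_neg hX, leviCivita_smul hη hξ,
    S.mvfderiv_η hX, leviCivita_end_apply S.smooth_φ hX, map_add, S.φ_sq, neg_apply] at h1
  linear_combination (norm := module) -h1

theorem dTwoForm_Φ (hX : MDiffAt (T% X) x) (hY : MDiffAt (T% Y) x) (hZ : MDiffAt (T% Z) x) :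
    dTwoForm S.Φ X Y Z x = inner ℝ (Y x) (covEnd S.smooth_φ x (Z x) (X x))
      + inner ℝ (Z x) (covEnd S.smooth_φ x (X x) (Y x))
      + inner ℝ (X x) (covEnd S.smooth_φ x (Y x) (Z x)) := by
  simp only [dTwoForm, Φ]
  rw [mvfderiv_inner_leviCivita hY (S.smooth_φ.mdifferentiableAt_apply hZ),
    mvfderiv_inner_leviCivita hZ (S.smooth_φ.mdifferentiableAt_apply hX),
    mvfderiv_inner_leviCivita hX (S.smooth_φ.mdifferentiableAt_apply hY),
    leviCivita_end_apply S.smooth_φ hX, leviCivita_end_apply S.smooth_φ hY,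
    leviCivita_end_apply S.smooth_φ hZ, mlieBracket_eq hX hY, mlieBracket_eq hY hZ,
    mlieBracket_eq hZ hX]
  have h : ∀ v w : TangentSpace I x, inner ℝ v (S.φ x w) = - inner ℝ w (S.φ x v) := fun v w => by
    rw [real_inner_comm, inner_φ_left]
  simp only [inner_sub_left, inner_add_right]
  rw [h (Y x) (leviCivita Z x (X x)), h (Z x) (leviCivita X x (Y x)),
    h (X x) (leviCivita Y x (Z x))]
  ring

/-- Once brackets are expanded by the torsion-free connection, all derivatives of `X` and `Y` cancel
and only those of `φ` survive outside `dη`. -/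
theorem N_eq (hX : MDiffAt (T% X) x) (hY : MDiffAt (T% Y) x) :
    S.N X Y x = covEnd S.smooth_φ x (Y x) (S.φ x (X x)) - covEnd S.smooth_φ x (X x) (S.φ x (Y x))
      + S.φ x (covEnd S.smooth_φ x (X x) (Y x)) - S.φ x (covEnd S.smooth_φ x (Y x) (X x))
      + dOneForm S.η X Y x • S.ξ x := by
  have hφX := S.smooth_φ.mdifferentiableAt_apply hX
  have hφY := S.smooth_φ.mdifferentiableAt_apply hY
  rw [N, nijenhuis, mlieBracket_eq hφX hφY, mlieBracket_eq hX hY, mlieBracket_eq hφX hY,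
    mlieBracket_eq hX hφY]
  simp only [leviCivita_end_apply S.smooth_φ hX, leviCivita_end_apply S.smooth_φ hY, map_add,
    map_sub]
  abel

end AlmostContactMetricStructure

end ContactGeometry

namespace ContactGeometry

variable {E : Type*} [NormedAddCommGroup E] [NormedSpace ℝ E]
  {H : Type*} [TopologicalSpace H] {I : ModelWithCorners ℝ E H}
  {M : Type*} [TopologicalSpace M] [ChartedSpace H M] [IsManifold I ∞ M]
  [RiemannianBundle (fun x : M => TangentSpace I x)]

/-! ### The pointwise model of a canonical structure -/

namespace AlmostThreeContactMetricStructure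

open AlmostContactMetricStructure

variable (S : AlmostThreeContactMetricStructure I M)

theorem η_ξ_ne {i j : Fin 3} (h : i ≠ j) (x : M) : (S.str j).η x ((S.str i).ξ x) = 0 := by
  have key : ∀ {i j k}, IsEvenPerm i j k → (S.str j).η x ((S.str i).ξ x) = 0 := fun {i j k} h => by
    rw [S.ξ_eq j k i h.rotate, η_φ]
  rcases (isEvenPerm_self i).eq_or j with rfl | rfl | rfl
  · exact absurd rfl h
  · exact key (isEvenPerm_self i)
  · have h1 := S.η_ξ_add _ _ _ (isEvenPerm_self i).rotate.rotate x
    have h2 := key (isEvenPerm_self i).rotate.rotate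
    linarith

/-- The tensors of an almost 3-contact metric structure at a point. -/
noncomputable def toLinear (x : M) : LinearThreeContact (TangentSpace I x) where
  φ i := ((S.str i).φ x).toLinearMap
  ξ i := (S.str i).ξ x
  inner_ξ_self i := by rw [inner_ξ, (S.str i).η_ξ]
  inner_ξ_ne i j h := by rw [inner_ξ, S.η_ξ_ne h]
  φ_skew i v w := inner_φ_left x v w
  φ_sq i v := by
    rw [inner_ξ]; exact (S.str i).φ_sq x v
  φ_mul i j k h v := by
    have h1 := S.φ_eq i j k h x v
    rw [inner_ξ]
    exact (eq_add_of_sub_eq h1.symm)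
  φ_mul' i j k h v := by
    have h1 := S.φ_eq' i j k h x v
    rw [inner_ξ]
    simp only [ContinuousLinearMap.coe_coe, h1]
    abel
  φ_ξ_self i := φ_ξ x
  φ_ξ i j k h := (S.ξ_eq i j k h x).symm
  φ_ξ' i j k h := by
    rw [S.ξ_eq' i j k h x, neg_neg]; rfl

theorem isHor_iff {x : M} {v : TangentSpace I x} :
    (S.toLinear x).IsHor v ↔ v ∈ S.horizontal x := by
  simp only [LinearThreeContact.IsHor, toLinear, inner_ξ, horizontal, Submodule.mem_iInf,
    LinearMap.mem_ker, ContinuousLinearMap.coe_coe]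

variable {S} [FiniteDimensional ℝ E] [T2Space M]

/-- Projecting any smooth extension horizontally keeps it smooth and does not alter its value at
`x`. Conditions stated for horizontal fields thereby become pointwise identities. -/
theorem exists_isSmoothHorizontal_apply_eq
    [IsContMDiffRiemannianBundle I ∞ E (fun x : M => TangentSpace I x)]
    {x : M} {v : TangentSpace I x}
    (hv : (S.toLinear x).IsHor v) :
    ∃ X : Π x : M, TangentSpace I x, S.IsSmoothHorizontal X ∧ X x = v := by
  obtain ⟨X, hX, rfl⟩ := exists_isSmoothVF_apply_eq x v
  refine ⟨fun y => (S.toLinear y).hor (X y), ⟨?_, fun y => ?_⟩, ?_⟩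
  · exact hX.sub (.sum fun i _ => .smul (hX.inner (S.str i).smooth_ξ) (S.str i).smooth_ξ)
  · exact S.isHor_iff.1 (LinearThreeContact.isHor_hor _)
  · exact hv.hor_eq

variable [IsContMDiffRiemannianBundle I ∞ E (fun x : M => TangentSpace I x)]

/-- For a Killing field `dη(X,Y) = 2 g(∇_X ξ, Y)`; the Lie derivative term cancels half of the two
`dη` terms. -/
theorem A_apply {X Y : Π x : M, TangentSpace I x} (i : Fin 3) {j : Fin 3}
    (h : IsKilling (S.str j).ξ) (hX : IsSmoothVF X) (hY : IsSmoothVF Y) (x : M) :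
    S.A i j X Y x = inner ℝ (covEnd (S.str i).smooth_φ x (X x) ((S.str j).ξ x)) (Y x)
      + inner ℝ (leviCivita (S.str j).ξ x ((S.str i).φ x (X x))) (Y x)
      + inner ℝ (leviCivita (S.str j).ξ x (X x)) ((S.str i).φ x (Y x)) := by
  have hX' := hX.mdifferentiableAt x
  have hY' := hY.mdifferentiableAt x
  have hξ := (S.str j).smooth_ξ.mdifferentiableAt x
  rw [A, lieDerivEnd_eq (S.str i).smooth_φ hξ hX',
    dOneForm_η _ hX' ((S.str i).smooth_φ.mdifferentiableAt_apply hY'),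
    dOneForm_η _ ((S.str i).smooth_φ.mdifferentiableAt_apply hX') hY', inner_add_left,
    inner_sub_left, inner_φ_left]
  have hk := h.inner_leviCivita_add x
  have h1 := hk (X x) ((S.str i).φ x (Y x))
  have h2 := hk ((S.str i).φ x (X x)) (Y x)
  rw [real_inner_comm _ ((S.str i).φ x (Y x)), real_inner_comm _ (X x),
    real_inner_comm _ (Y x), real_inner_comm _ ((S.str i).φ x (X x))]
  linarith

/-- The Levi-Civita derivatives of a canonical structure at a point. -/
noncomputable def toLinearCanonical (hS : S.IsCanonical) {β : M → ℝ}
    (hβ : S.IsReebKillingFunction β) (x : M) : LinearCanonical (TangentSpace I x) where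
  toLinearThreeContact := S.toLinear x
  P i := (leviCivita (S.str i).ξ x).toLinearMap
  D i := (ContinuousLinearMap.coeLM ℝ) ∘ₗ (covEnd (S.str i).smooth_φ x).toLinearMap
  β := β x
  P_skew i u v := (hS.killing i).inner_leviCivita_add x u v
  P_ξ i j u := by
    have h1 := mvfderiv_inner_leviCivita ((S.str i).smooth_ξ.mdifferentiableAt x)
      ((S.str j).smooth_ξ.mdifferentiableAt x) u
    have h2 : (fun y => inner ℝ ((S.str i).ξ y) ((S.str j).ξ y))
        = fun _ : M => if i = j then (1 : ℝ) else 0 :=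
      funext fun y => (S.toLinear y).inner_ξ i j
    rw [h2, mvfderiv_const, real_inner_comm _ ((S.str i).ξ x)] at h1
    exact eq_neg_of_add_eq_zero_left h1.symm
  D_skew i u v w := by
    obtain ⟨X, hX, rfl⟩ := exists_isSmoothVF_apply_eq x w
    obtain ⟨Y, hY, rfl⟩ := exists_isSmoothVF_apply_eq x v
    exact (S.str i).covEnd_skew (hX.mdifferentiableAt x) (hY.mdifferentiableAt x) u
  D_φ i u w := by
    obtain ⟨X, hX, rfl⟩ := exists_isSmoothVF_apply_eq x w
    have h := (S.str i).covEnd_φ (hX.mdifferentiableAt x) u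
    rw [← inner_ξ, real_inner_comm (leviCivita (S.str i).ξ x u)] at h
    exact h
  D_ξ_self i u := by
    have h := leviCivita_end_apply (S.str i).smooth_φ ((S.str i).smooth_ξ.mdifferentiableAt x) u
    have h2 : (fun y => (S.str i).φ y ((S.str i).ξ y)) = 0 := funext fun y => φ_ξ y
    rw [h2, leviCivita.zero] at h
    exact eq_neg_of_add_eq_zero_left h.symm
  D_ξ i j k h u := by
    have h1 := leviCivita_end_apply (S.str i).smooth_φ ((S.str j).smooth_ξ.mdifferentiableAt x) u
    have h2 : (fun y => (S.str i).φ y ((S.str j).ξ y)) = (S.str k).ξ :=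
      funext fun y => (S.ξ_eq i j k h y).symm
    rw [h2] at h1
    exact eq_sub_of_add_eq h1.symm
  D_ξ' i j k h u := by
    have h1 := leviCivita_end_apply (S.str i).smooth_φ ((S.str k).smooth_ξ.mdifferentiableAt x) u
    have h2 : (fun y => (S.str i).φ y ((S.str k).ξ y)) = fun y => - (S.str j).ξ y :=
      funext fun y => by rw [S.ξ_eq' k i j h.rotate.rotate y, neg_neg]
    rw [h2, leviCivita_neg ((S.str j).smooth_ξ.mdifferentiableAt x)] at h1
    exact eq_sub_of_add_eq h1.symm
  N_skew i u v w hu hv hw := by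
    obtain ⟨X, hX, rfl⟩ := exists_isSmoothHorizontal_apply_eq hu
    obtain ⟨Y, hY, rfl⟩ := exists_isSmoothHorizontal_apply_eq hv
    obtain ⟨Z, hZ, rfl⟩ := exists_isSmoothHorizontal_apply_eq hw
    have hX' := hX.1.mdifferentiableAt x
    have h := (hS.skew i X Y Z hX.1 hY.1 hZ.1 hX.2 hY.2 hZ.2 x).2
    -- The `dη ⊗ ξ` summand of `N` drops out against horizontal vectors, which is why the pointwise
    -- model omits it.
    rw [N_eq _ hX' (hY.1.mdifferentiableAt x), N_eq _ hX' (hZ.1.mdifferentiableAt x),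
      inner_add_left, inner_add_left _ _ (Z x), real_inner_smul_left, real_inner_smul_left,
      real_inner_comm (Y x) ((S.str i).ξ x),
      real_inner_comm (Z x) ((S.str i).ξ x)] at h
    have h1 : inner ℝ (Y x) ((S.str i).ξ x) = 0 := hv i
    have h2 : inner ℝ (Z x) ((S.str i).ξ x) = 0 := hw i
    rw [h1, h2, mul_zero, mul_zero, add_zero, add_zero] at h
    exact h
  N_sub_dΦ i j u v w hu hv hw := by
    obtain ⟨X, hX, rfl⟩ := exists_isSmoothHorizontal_apply_eq hu
    obtain ⟨Y, hY, rfl⟩ := exists_isSmoothHorizontal_apply_eq hv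
    obtain ⟨Z, hZ, rfl⟩ := exists_isSmoothHorizontal_apply_eq hw
    have hX' := hX.1.mdifferentiableAt x
    have hY' := hY.1.mdifferentiableAt x
    have hZ' := hZ.1.mdifferentiableAt x
    have h := hS.N_sub_dΦ i j X Y Z hX hY hZ x
    have key : ∀ l, S.NMinusdΦ l X Y Z x = _ := fun l => by
      have h1 : inner ℝ (Z x) ((S.str l).ξ x) = 0 := hw l
      rw [NMinusdΦ, dTwoForm_Φ _ ((S.str l).smooth_φ.mdifferentiableAt_apply hX')
        ((S.str l).smooth_φ.mdifferentiableAt_apply hY')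
        ((S.str l).smooth_φ.mdifferentiableAt_apply hZ'), N_eq _ hX' hY',
        inner_add_left _ _ (Z x), real_inner_smul_left, 
        real_inner_comm (Z x) ((S.str l).ξ x), h1, mul_zero, add_zero]
    rw [key, key] at h
    exact h
  A_self i u v hu hv := by
    obtain ⟨X, hX, rfl⟩ := exists_isSmoothHorizontal_apply_eq hu
    obtain ⟨Y, hY, rfl⟩ := exists_isSmoothHorizontal_apply_eq hv
    have h := (hβ.2 X Y hX hY _ _ _ (isEvenPerm_self i) x).1
    rw [A_apply _ (hS.killing i) hX.1 hY.1] at h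
    exact h
  A_eq i j k hi u v hu hv := by
    obtain ⟨X, hX, rfl⟩ := exists_isSmoothHorizontal_apply_eq hu
    obtain ⟨Y, hY, rfl⟩ := exists_isSmoothHorizontal_apply_eq hv
    have h := (hβ.2 X Y hX hY _ _ _ hi x).2.2
    rw [A_apply _ (hS.killing j) hX.1 hY.1] at h
    exact h
  A_eq' i j k hi u v hu hv := by
    obtain ⟨X, hX, rfl⟩ := exists_isSmoothHorizontal_apply_eq hu
    obtain ⟨Y, hY, rfl⟩ := exists_isSmoothHorizontal_apply_eq hv
    obtain ⟨-, h1, h2⟩ := hβ.2 X Y hX hY _ _ _ hi x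
    rw [h2, A_apply _ (hS.killing i) hX.1 hY.1] at h1
    exact (neg_eq_iff_eq_neg.2 h1).symm

end AlmostThreeContactMetricStructure

end ContactGeometry

/-! ### General facts on characteristic connections and the tensor `N` -/

namespace ContactGeometry

theorem exists_clm_inner_eq {V : Type*} [NormedAddCommGroup V] [InnerProductSpace ℝ V]
    [FiniteDimensional ℝ V] (T : V → V → V → ℝ)
    (add₁ : ∀ u u' v w, T (u + u') v w = T u v w + T u' v w)
    (smul₁ : ∀ (c : ℝ) u v w, T (c • u) v w = c * T u v w)
    (add₂ : ∀ u v v' w, T u (v + v') w = T u v w + T u v' w)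
    (smul₂ : ∀ (c : ℝ) u v w, T u (c • v) w = c * T u v w)
    (add₃ : ∀ u v w w', T u v (w + w') = T u v w + T u v w')
    (smul₃ : ∀ (c : ℝ) u v w, T u v (c • w) = c * T u v w) :
    ∃ A : V →L[ℝ] V →L[ℝ] V, ∀ u v w, inner ℝ (A v u) w = T u v w := by
  let b := stdOrthonormalBasis ℝ V
  let B : V →ₗ[ℝ] V →ₗ[ℝ] V := LinearMap.mk₂ ℝ (fun v u => ∑ i, T u v (b i) • b i)
    (fun v v' u => by simp only [add₂, add_smul, Finset.sum_add_distrib])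
    (fun c v u => by simp only [smul₂, mul_smul, Finset.smul_sum])
    (fun v u u' => by simp only [add₁, add_smul, Finset.sum_add_distrib])
    (fun c v u => by simp only [smul₁, mul_smul, Finset.smul_sum])
  refine ⟨B.toContinuousBilinearMap, fun u v w => ?_⟩
  let f : V →ₗ[ℝ] ℝ :=
    { toFun := T u v
      map_add' := add₃ u v
      map_smul' := fun c w => smul₃ c u v w }
  have h : f w = ∑ i, inner ℝ (b i) w * f (b i) := by
    conv_lhs => rw [← b.sum_repr' w]
    simp only [map_sum, map_smul, smul_eq_mul]
  have h2 : B.toContinuousBilinearMap v u = ∑ i, T u v (b i) • b i := rfl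
  rw [h2, sum_inner]
  refine Eq.trans ?_ h.symm
  exact Finset.sum_congr rfl fun i _ => by rw [real_inner_smul_left, mul_comm]; rfl

variable {E : Type*} [NormedAddCommGroup E] [NormedSpace ℝ E] [FiniteDimensional ℝ E]
  {H : Type*} [TopologicalSpace H] {I : ModelWithCorners ℝ E H}
  {M : Type*} [TopologicalSpace M] [ChartedSpace H M] [IsManifold I ∞ M]
  [RiemannianBundle (fun x : M => TangentSpace I x)]

namespace AlmostContactMetricStructure

variable {S : AlmostContactMetricStructure I M}
  {cov : CovariantDerivative I E (fun x : M => TangentSpace I x)}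

/-- A metric connection which parallelizes `φ` also parallelizes `ξ` and `η`. -/
theorem isCharacteristicConnection_of_parallel_φ
    (smooth : CovariantDerivative.ContMDiffCovariantDerivative cov ∞)
    (metric : ∀ X Y Z : Π x : M, TangentSpace I x, IsSmoothVF X → IsSmoothVF Y → IsSmoothVF Z →
      ∀ x : M, mvfderiv I (fun y => inner ℝ (Y y) (Z y)) x (X x)
        = inner ℝ (cov Y x (X x)) (Z x) + inner ℝ (Y x) (cov Z x (X x)))
    (skew_torsion : ∀ (x : M) (u v w : TangentSpace I x),
      inner ℝ (cov.torsion x v u) w = - inner ℝ (cov.torsion x u v) w ∧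
      inner ℝ (cov.torsion x u w) v = - inner ℝ (cov.torsion x u v) w)
    (parallel_φ : ∀ X Y : Π x : M, TangentSpace I x, IsSmoothVF X → IsSmoothVF Y → ∀ x : M,
      cov (fun y => S.φ y (Y y)) x (X x) - S.φ x (cov Y x (X x)) = 0) :
    S.IsCharacteristicConnection cov := by
  have hξ : ∀ X : Π x : M, TangentSpace I x, IsSmoothVF X → ∀ x : M, cov S.ξ x (X x) = 0 := by
    intro X hX x
    have h1 := parallel_φ X S.ξ hX S.smooth_ξ x
    have h2 : (fun y => S.φ y (S.ξ y)) = 0 := funext fun y => φ_ξ y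
    rw [h2, cov.zero, sub_eq_zero] at h1
    have h3 := metric X S.ξ S.ξ hX S.smooth_ξ S.smooth_ξ x
    have h4 : (fun y => inner ℝ (S.ξ y) (S.ξ y)) = fun _ : M => (1 : ℝ) :=
      funext fun y => by rw [inner_ξ, S.η_ξ]
    rw [h4, mvfderiv_const, real_inner_comm _ (S.ξ x), inner_ξ] at h3
    have h5 : S.η x (cov S.ξ x (X x)) = 0 := by
      have h6 : (0 : TangentSpace I x →L[ℝ] ℝ) (X x) = 0 := rfl
      linarith
    -- `∇ξ` is annihilated by `φ` because `φξ = 0` and `φ` is parallel, and by `η` because `ξ` has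
    -- unit length; hence `-∇ξ = φ²∇ξ = 0`.
    have h7 := S.φ_sq x (cov S.ξ x (X x))
    rw [← h1, h5, zero_smul, add_zero] at h7
    have h8 : S.φ x 0 = 0 := map_zero _
    exact neg_eq_zero.1 (h7.symm.trans h8)
  refine ⟨smooth, metric, skew_torsion, parallel_φ, hξ, fun X Y hX hY x => ?_⟩
  have h1 := metric X Y S.ξ hX hY S.smooth_ξ x
  have h2 : (fun y => S.η y (Y y)) = fun y => inner ℝ (Y y) (S.ξ y) :=
    funext fun y => (inner_ξ y _).symm
  rw [h2, h1, hξ X hX, inner_zero_right, inner_ξ, add_zero, sub_self]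

/-- After writing `[X,Y] = ∇_X Y - ∇_Y X - T(X,Y)`, parallelism of `φ` cancels every derivative.
Parallelism of `η` gives `dη = η ∘ T`, and this cancels the `ξ`-component coming from `φ² T(X,Y)`.
-/
theorem IsCharacteristicConnection.N_eq (h : S.IsCharacteristicConnection cov)
    {X Y : Π x : M, TangentSpace I x} (hX : IsSmoothVF X) (hY : IsSmoothVF Y) (x : M) :
    S.N X Y x = cov.torsion x (X x) (Y x) - cov.torsion x (S.φ x (X x)) (S.φ x (Y x))
      + S.φ x (cov.torsion x (S.φ x (X x)) (Y x)) + S.φ x (cov.torsion x (X x) (S.φ x (Y x))) := by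
  have hφX : IsSmoothVF fun y => S.φ y (X y) := hX.end_apply S.smooth_φ
  have hφY : IsSmoothVF fun y => S.φ y (Y y) := hY.end_apply S.smooth_φ
  have hb : ∀ {X Y : Π x : M, TangentSpace I x}, IsSmoothVF X → IsSmoothVF Y →
      mlieBracket I X Y x = cov Y x (X x) - cov X x (Y x) - cov.torsion x (X x) (Y x) := by
    intro X Y hX hY
    rw [cov.torsion_apply (hX.mdifferentiableAt x) (hY.mdifferentiableAt x)]
    abel
  have hp := fun {X Y : Π x : M, TangentSpace I x} (hX : IsSmoothVF X) (hY : IsSmoothVF Y) =>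
    sub_eq_zero.1 (h.parallel_φ X Y hX hY x)
  have hη := fun {X Y : Π x : M, TangentSpace I x} (hX : IsSmoothVF X) (hY : IsSmoothVF Y) =>
    sub_eq_zero.1 (h.parallel_η X Y hX hY x)
  have h1 : dOneForm S.η X Y x = S.η x (cov.torsion x (X x) (Y x)) := by
    rw [dOneForm, hη hX hY, hη hY hX, hb hX hY, map_sub, map_sub]
    ring
  rw [N, nijenhuis, h1, hb hφX hφY, hb hX hY, hb hφX hY, hb hX hφY, hp hX hY, hp hY hX, hp hφX hY,
    hp hφY hX]
  simp only [map_sub]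
  rw [S.φ_sq x (cov.torsion x (X x) (Y x))]
  module

/-- Moving `φ` to the third argument turns the formula for `N` into `T` minus the sum of its three
versions with `φ` in two slots, which is skew when `T` is. -/
theorem IsCharacteristicConnection.isSkewOn_N (h : S.IsCharacteristicConnection cov) :
    IsSkewOn (fun _ : M => ⊤) S.N := by
  intro X Y Z hX hY hZ _ _ _ x
  have hl := fun u v w => (h.skew_torsion x u v w).1
  have hr := fun u v w => (h.skew_torsion x u v w).2
  rw [h.N_eq hX hY, h.N_eq hY hX, h.N_eq hX hZ]
  simp only [inner_sub_left, inner_add_left, inner_φ_left]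
  constructor
  · rw [hl (X x) (Y x), hl (S.φ x (X x)) (S.φ x (Y x)), hl (X x) (S.φ x (Y x)),
      hl (S.φ x (X x)) (Y x)]
    ring
  · rw [hr (X x) (Y x) (Z x), hr (S.φ x (X x)) (Y x) (S.φ x (Z x)),
      hr (S.φ x (X x)) (S.φ x (Y x)) (Z x), hr (X x) (S.φ x (Y x)) (S.φ x (Z x))]
    ring

end AlmostContactMetricStructure

end ContactGeometry

namespace ContactGeometry

variable {E : Type*} [NormedAddCommGroup E] [NormedSpace ℝ E] [FiniteDimensional ℝ E]
  {H : Type*} [TopologicalSpace H] {I : ModelWithCorners ℝ E H}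
  {M : Type*} [TopologicalSpace M] [ChartedSpace H M] [IsManifold I ∞ M] [T2Space M]
  [RiemannianBundle (fun x : M => TangentSpace I x)]
  [IsContMDiffRiemannianBundle I ∞ E (fun x : M => TangentSpace I x)]

namespace AlmostThreeContactMetricStructure

open AlmostContactMetricStructure

variable {S : AlmostThreeContactMetricStructure I M} (hS : S.IsCanonical) {β : M → ℝ}
  (hβ : S.IsReebKillingFunction β) (a : Fin 3 → ℝ)
  {X Y Z W : Π x : M, TangentSpace I x} {x : M}

/-! ### Smoothness of the torsion -/

omit [FiniteDimensional ℝ E] [T2Space M] in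
theorem isSmoothVF_hor (hX : IsSmoothVF X) : IsSmoothVF (fun x => (S.toLinear x).hor (X x)) :=
  hX.sub (.sum fun i _ => .smul (hX.inner (S.str i).smooth_ξ) (S.str i).smooth_ξ)

omit [FiniteDimensional ℝ E] [T2Space M] in
theorem contMDiff_vol (hX : IsSmoothVF X) (hY : IsSmoothVF Y) (hZ : IsSmoothVF Z) :
    ContMDiff I 𝓘(ℝ, ℝ) ∞ (fun x => (S.toLinear x).vol (X x) (Y x) (Z x)) := by
  have h := fun {X : Π x : M, TangentSpace I x} (hX : IsSmoothVF X) i =>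
    hX.inner (S.str i).smooth_ξ
  exact (((h hX 0).mul (((h hY 1).mul (h hZ 2)).sub ((h hY 2).mul (h hZ 1)))).add
    ((h hX 1).mul (((h hY 2).mul (h hZ 0)).sub ((h hY 0).mul (h hZ 2))))).add
    ((h hX 2).mul (((h hY 0).mul (h hZ 1)).sub ((h hY 1).mul (h hZ 0))))

omit [FiniteDimensional ℝ E] [T2Space M] in
theorem contMDiff_sumEtaPhi (hX : IsSmoothVF X) (hY : IsSmoothVF Y) (hZ : IsSmoothVF Z) :
    ContMDiff I 𝓘(ℝ, ℝ) ∞ (fun x => (S.toLinear x).sumEtaPhi (X x) (Y x) (Z x)) := by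
  have h := fun {X : Π x : M, TangentSpace I x} (hX : IsSmoothVF X) i =>
    hX.inner (S.str i).smooth_ξ
  have h2 := fun {X Y : Π x : M, TangentSpace I x} (hX : IsSmoothVF X) (hY : IsSmoothVF Y) i =>
    hX.inner (hY.end_apply (S.str i).smooth_φ)
  exact contMDiff_finsetSum fun i _ => (((h hX i).mul (h2 hY hZ i)).add
    ((h hY i).mul (h2 hZ hX i))).add ((h hZ i).mul (h2 hX hY i))

omit [FiniteDimensional ℝ E] [T2Space M] in
theorem contMDiff_etaPhi (hX : IsSmoothVF X) (hY : IsSmoothVF Y) (hZ : IsSmoothVF Z) :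
    ContMDiff I 𝓘(ℝ, ℝ) ∞ (fun x => (S.toLinear x).etaPhi a (X x) (Y x) (Z x)) := by
  have hξ : IsSmoothVF (fun x => ∑ i, a i • (S.str i).ξ x) :=
    .sum fun i _ => .smul contMDiff_const (S.str i).smooth_ξ
  have hφ := fun {X : Π x : M, TangentSpace I x} (hX : IsSmoothVF X) =>
    (IsSmoothVF.sum fun i (_ : i ∈ Finset.univ) =>
      .smul contMDiff_const (hX.end_apply (S.str i).smooth_φ) :
      IsSmoothVF (fun x => ∑ i, a i • (S.str i).φ x (X x)))
  exact (((hX.inner hξ).mul (hY.inner (hφ hZ))).add ((hY.inner hξ).mul (hZ.inner (hφ hX)))).add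
    ((hZ.inner hξ).mul (hX.inner (hφ hY)))

theorem isSmoothVF_covEnd {φ : Π x : M, TangentSpace I x →L[ℝ] TangentSpace I x}
    (hφ : IsSmoothEnd φ) (hX : IsSmoothVF X) (hW : IsSmoothVF W) :
    IsSmoothVF (fun x => covEnd hφ x (W x) (X x)) := by
  have h : (fun x => covEnd hφ x (W x) (X x))
      = fun x => leviCivita (fun y => φ y (W y)) x (X x) - φ x (leviCivita W x (X x)) :=
    funext fun x => covEnd_apply hφ (hW.mdifferentiableAt x) (X x)
  rw [h]
  exact (isSmoothVF_leviCivita hX (hW.end_apply hφ)).sub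
    ((isSmoothVF_leviCivita hX hW).end_apply hφ)

theorem contMDiff_torsion (hX : IsSmoothVF X) (hY : IsSmoothVF Y) (hZ : IsSmoothVF Z) :
    ContMDiff I 𝓘(ℝ, ℝ) ∞
      (fun x => (toLinearCanonical hS hβ x).torsion (X x) (Y x) (Z x)) := by
  have hP := fun {X : Π x : M, TangentSpace I x} (hX : IsSmoothVF X) i =>
    isSmoothVF_leviCivita hX (S.str i).smooth_ξ
  have hh := fun {X : Π x : M, TangentSpace I x} (hX : IsSmoothVF X) =>
    isSmoothVF_hor (S := S) hX
  have hφ := fun {X : Π x : M, TangentSpace I x} (hX : IsSmoothVF X) =>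
    hX.end_apply (S.str 0).smooth_φ
  have hD := fun {X Y : Π x : M, TangentSpace I x} (hX : IsSmoothVF X) (hY : IsSmoothVF Y) =>
    isSmoothVF_covEnd (S.str 0).smooth_φ hX hY
  have hq : ∀ {X Y : Π x : M, TangentSpace I x}, IsSmoothVF X → IsSmoothVF Y → ∀ l,
      ContMDiff I 𝓘(ℝ, ℝ) ∞ (fun x => (toLinearCanonical hS hβ x).q l (X x) (Y x)) :=
    fun hX hY l => ((hP (hh hX) l).inner hY).add ((hP hX l).inner (hh hY))
  have h := fun {X : Π x : M, TangentSpace I x} (hX : IsSmoothVF X) i =>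
    hX.inner (S.str i).smooth_ξ
  have hτ : ∀ {X Y Z : Π x : M, TangentSpace I x}, IsSmoothVF X → IsSmoothVF Y → IsSmoothVF Z →
      ContMDiff I 𝓘(ℝ, ℝ) ∞ (fun x => (toLinearCanonical hS hβ x).τ 0 (X x) (Y x) (Z x)) :=
    fun hX hY hZ => (((hφ hZ).inner (hD hX hY)).sub ((hφ hZ).inner (hD hY hX))).add
      (hX.inner (hD (hφ hZ) hY))
  have hb : ContMDiff I 𝓘(ℝ, ℝ) ∞
      (fun x => 2 * (β x + inner ℝ (leviCivita (S.str 0).ξ x ((S.str 1).ξ x)) ((S.str 2).ξ x))) :=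
    contMDiff_const.mul (hβ.1.add ((hP (S.str 1).smooth_ξ 0).inner (S.str 2).smooth_ξ))
  exact ((hτ (hh hX) (hh hY) (hh hZ)).add (contMDiff_finsetSum fun l _ =>
    (((h hX l).mul (hq hY hZ l)).add ((h hY l).mul (hq hZ hX l))).add
      ((h hZ l).mul (hq hX hY l)))).add (hb.mul (contMDiff_vol hX hY hZ))

theorem contMDiff_charTorsion (hX : IsSmoothVF X) (hY : IsSmoothVF Y) (hZ : IsSmoothVF Z) :
    ContMDiff I 𝓘(ℝ, ℝ) ∞
      (fun x => (toLinearCanonical hS hβ x).charTorsion a (X x) (Y x) (Z x)) :=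
  (contMDiff_torsion hS hβ hX hY hZ).add
    (hβ.1.mul ((contMDiff_sumEtaPhi hX hY hZ).sub (contMDiff_etaPhi a hX hY hZ)))

/-! ### The characteristic connections -/

theorem exists_charOneForm (x : M) :
    ∃ A : TangentSpace I x →L[ℝ] TangentSpace I x →L[ℝ] TangentSpace I x, ∀ u v w,
      inner ℝ (A v u) w = 1 / 2 * (toLinearCanonical hS hβ x).charTorsion a u v w := by
  have := finiteDimensional_tangentSpace (I := I) x
  refine exists_clm_inner_eq
    (fun u v w => 1 / 2 * (toLinearCanonical hS hβ x).charTorsion a u v w) ?_ ?_ ?_ ?_ ?_ ?_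
  all_goals intros
  · rw [LinearCanonical.charTorsion_add]; ring
  · rw [LinearCanonical.charTorsion_smul]; ring
  · rw [LinearCanonical.charTorsion_add_middle]; ring
  · rw [LinearCanonical.charTorsion_smul_middle]; ring
  · rw [LinearCanonical.charTorsion_add_right]; ring
  · rw [LinearCanonical.charTorsion_smul_right]; ring

/-- The metric connection with torsion `charTorsion a`. -/
noncomputable def charConnection : CovariantDerivative I E (fun x : M => TangentSpace I x) :=
  -- The pointwise choice is harmless: its inner products determine it, and smoothness is recovered
  -- from them by `isSmoothVF_of_inner`.
  leviCivita.addOneForm fun x => (exists_charOneForm hS hβ a x).choose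

theorem inner_charConnection (Y : Π x : M, TangentSpace I x) (x : M) (u w : TangentSpace I x) :
    inner ℝ (charConnection hS hβ a Y x u) w = inner ℝ (leviCivita Y x u) w
      + 1 / 2 * (toLinearCanonical hS hβ x).charTorsion a u (Y x) w := by
  rw [← (exists_charOneForm hS hβ a x).choose_spec u (Y x) w, ← inner_add_left]
  rfl

theorem contMDiff_charConnection :
    CovariantDerivative.ContMDiffCovariantDerivative (charConnection hS hβ a) ∞ :=
  contMDiffCovariantDerivative_of_apply fun X Y hX hY => isSmoothVF_of_inner fun Z hZ => by
    have h : (fun x => inner ℝ (Z x) (charConnection hS hβ a Y x (X x)))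
        = fun x => inner ℝ (leviCivita Y x (X x)) (Z x)
          + 1 / 2 * (toLinearCanonical hS hβ x).charTorsion a (X x) (Y x) (Z x) :=
      funext fun x => by rw [real_inner_comm, inner_charConnection]
    rw [h]
    exact ((isSmoothVF_leviCivita hX hY).inner hZ).add
      (contMDiff_const.mul (contMDiff_charTorsion hS hβ a hX hY hZ))

theorem mvfderiv_inner_charConnection (hY : IsSmoothVF Y) (hZ : IsSmoothVF Z)
    (u : TangentSpace I x) :
    mvfderiv I (fun y => inner ℝ (Y y) (Z y)) x u
      = inner ℝ (charConnection hS hβ a Y x u) (Z x)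
        + inner ℝ (Y x) (charConnection hS hβ a Z x u) := by
  rw [mvfderiv_inner_leviCivita (hY.mdifferentiableAt x) (hZ.mdifferentiableAt x),
    real_inner_comm _ (Y x), real_inner_comm _ (Y x), inner_charConnection, inner_charConnection,
    LinearCanonical.charTorsion_swap_right a u (Y x) (Z x)]
  ring

/-- The Levi-Civita part has no torsion, and skew-symmetrizing the added half of `charTorsion`
restores the whole of it. -/
theorem inner_torsion_charConnection (u v w : TangentSpace I x) :
    inner ℝ ((charConnection hS hβ a).torsion x u v) w
      = (toLinearCanonical hS hβ x).charTorsion a u v w := by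
  obtain ⟨X, hX, rfl⟩ := exists_isSmoothVF_apply_eq x u
  obtain ⟨Y, hY, rfl⟩ := exists_isSmoothVF_apply_eq x v
  have hX' := hX.mdifferentiableAt x
  have hY' := hY.mdifferentiableAt x
  rw [CovariantDerivative.torsion_apply _ hX' hY', mlieBracket_eq hX' hY', inner_sub_left,
    inner_sub_left, inner_sub_left, inner_charConnection, inner_charConnection,
    LinearCanonical.charTorsion_swap_left a (X x) (Y x)]
  ring

omit [T2Space M] in
theorem leviCivita_sum_smul {ι : Type*} (s : Finset ι) (a : ι → ℝ) {W : ι → Π x : M, TangentSpace I x}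
    (hW : ∀ i, IsSmoothVF (W i)) (x : M) (u : TangentSpace I x) :
    leviCivita (fun y => ∑ i ∈ s, a i • W i y) x u = ∑ i ∈ s, a i • leviCivita (W i) x u := by
  classical
  induction s using Finset.induction_on with
  | empty =>
    have h : (fun y => ∑ i ∈ ∅, a i • W i y) = (0 : Π y : M, TangentSpace I y) := by
      funext y; simp
    rw [h, leviCivita.zero]
    simp
  | insert i s hi ih =>
    have hs : IsSmoothVF (fun y => ∑ i ∈ s, a i • W i y) :=
      .sum fun i _ => .smul contMDiff_const (hW i)
    have hi' : IsSmoothVF (fun y => a i • W i y) := .smul contMDiff_const (hW i)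
    have h1 : leviCivita (fun y => a i • W i y) x = a i • leviCivita (W i) x :=
      leviCivita.isCovariantDerivativeOn.smul_const (a i) ((hW i).mdifferentiableAt x)
    simp only [Finset.sum_insert hi]
    rw [leviCivita_add (hi'.mdifferentiableAt x) (hs.mdifferentiableAt x), add_apply, ih, h1,
      smul_apply]

variable {a}

/-- A structure in the associated sphere is parallel for the corresponding connection. -/
theorem isCharacteristicConnection_charConnection (ha : a 0 ^ 2 + a 1 ^ 2 + a 2 ^ 2 = 1)
    {T : AlmostContactMetricStructure I M} (hT : ∀ x v, T.φ x v = ∑ i, a i • (S.str i).φ x v) :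
    T.IsCharacteristicConnection (charConnection hS hβ a) := by
  refine isCharacteristicConnection_of_parallel_φ (contMDiff_charConnection hS hβ a)
    (fun X Y Z hX hY hZ x => mvfderiv_inner_charConnection hS hβ a hY hZ (X x))
    (fun x u v w => ?_) (fun X Y hX hY x => ?_)
  · simp only [inner_torsion_charConnection]
    exact ⟨LinearCanonical.charTorsion_swap_left a u v w,
      LinearCanonical.charTorsion_swap_right a u v w⟩
  · refine ext_inner_right ℝ fun v => ?_
    have h1 : (fun y => T.φ y (Y y)) = fun y => ∑ i, a i • (S.str i).φ y (Y y) :=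
      funext fun y => hT y (Y y)
    have h2 : inner ℝ v (∑ i, a i • covEnd (S.str i).smooth_φ x (Y x) (X x))
        + 1 / 2 * ((toLinearCanonical hS hβ x).charTorsion a (X x)
            (∑ i, a i • (S.str i).φ x (Y x)) v
          + (toLinearCanonical hS hβ x).charTorsion a (X x) (Y x)
            (∑ i, a i • (S.str i).φ x v)) = 0 :=
      LinearCanonical.D_add_charTorsion (S := toLinearCanonical hS hβ x) ha (X x) v (Y x)
    have h3 := leviCivita_sum_smul Finset.univ a (fun i => hY.end_apply (S.str i).smooth_φ) x (X x)
    rw [inner_zero_left, inner_sub_left, inner_φ_left, inner_charConnection, inner_charConnection,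
      h1, h3]
    simp only [hT]
    have h4 : ∀ i, leviCivita (fun y => (S.str i).φ y (Y y)) x (X x)
        = covEnd (S.str i).smooth_φ x (Y x) (X x) + (S.str i).φ x (leviCivita Y x (X x)) :=
      fun i => leviCivita_end_apply (S.str i).smooth_φ (hY.mdifferentiableAt x) (X x)
    have h5 := inner_φ_left (S := T) x (leviCivita Y x (X x)) v
    simp only [hT] at h5
    simp only [h4, smul_add, Finset.sum_add_distrib, inner_add_left, h5]
    rw [real_inner_comm v]
    linarith

end AlmostThreeContactMetricStructure

end ContactGeometry

/-! ### The main theorem -/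

theorem mainTheorem6 {n : ℕ} {M : Type*} [TopologicalSpace M] [T2Space M]
    [ChartedSpace (EuclideanSpace ℝ (Fin (4 * n + 3))) M] [IsManifold (𝓡 (4 * n + 3)) ∞ M]
    [RiemannianBundle (fun x : M => TangentSpace (𝓡 (4 * n + 3)) x)]
    [IsContMDiffRiemannianBundle (𝓡 (4 * n + 3)) ∞ (EuclideanSpace ℝ (Fin (4 * n + 3)))
      (fun x : M => TangentSpace (𝓡 (4 * n + 3)) x)]
    (S : AlmostThreeContactMetricStructure (𝓡 (4 * n + 3)) M) (hS : S.IsCanonical) :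
    (∀ i, IsSkewOn (fun _ : M => ⊤) (S.str i).N) ∧
    (∀ i, ∃ cov : CovariantDerivative (𝓡 (4 * n + 3)) (EuclideanSpace ℝ (Fin (4 * n + 3)))
        (fun x : M => TangentSpace (𝓡 (4 * n + 3)) x),
      (S.str i).IsCharacteristicConnection cov) ∧
    (∀ T ∈ S.associatedSphere,
      ∃ cov : CovariantDerivative (𝓡 (4 * n + 3)) (EuclideanSpace ℝ (Fin (4 * n + 3)))
        (fun x : M => TangentSpace (𝓡 (4 * n + 3)) x),
      T.IsCharacteristicConnection cov) := by
  obtain ⟨β, hβ⟩ := hS.reebKilling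
  have key : ∀ i, ∃ cov : CovariantDerivative (𝓡 (4 * n + 3)) (EuclideanSpace ℝ (Fin (4 * n + 3)))
      (fun x : M => TangentSpace (𝓡 (4 * n + 3)) x), (S.str i).IsCharacteristicConnection cov :=
    -- Each given structure is the point of the sphere with coordinate vector `e_i`.
    fun i => ⟨_, AlmostThreeContactMetricStructure.isCharacteristicConnection_charConnection hS hβ (a := Pi.single i 1)
      (by fin_cases i <;> simp) (fun x v => by simp [Pi.single_apply])⟩
  refine ⟨fun i => (key i).choose_spec.isSkewOn_N, key, ?_⟩
  rintro T ⟨a, ha, rfl⟩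
  exact ⟨_, AlmostThreeContactMetricStructure.isCharacteristicConnection_charConnection hS hβ
    (AlmostThreeContactMetricStructure.sum_sq_of_mem_sphere ha)
    (fun x v => by simp [AlmostThreeContactMetricStructure.combination])⟩
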